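/- Let $p$ be a prime, let $\ell\ge 2$ be an even integer, put $q=p^\ell$, and let $F$ be the finite field with $q$ elements. Let $\delta$ be a real number with $0<\delta<1-q^{-1}$ and $h_q(\delta)<\tfrac14$, where $$h_q(\delta)=\delta\log_q(q-1)-\delta\log_q\delta-(1-\delta)\log_q(1-\delta)$$ is the $q$-entropy function. For an integer $n>1$ let $\mathcal R_n=F[X]/\langle X^n-1\rangle$; identify $\mathcal R_n$ with $F^n$ through $\sum_{i=0}^{n-1}a_iX^i\leftrightarrow(a_0,\dots,a_{n-1})$, and $\mathcal R_n\times\mathcal R_n$ with $F^n\times F^n=F^{2n}$ componentwise. For $a=\sum_{i=0}^{n-1}a_iX^i\in\mathcal R_n$ put $a^*=\sum_{i=0}^{n-1}a_i^{p^{\ell/2}}X^{(n-1)i}\in\mathcal R_n$, and for $g\in\mathcal R_n$ let $C_{1,g}\subseteq F^{2n}$ be the code corresponding to the $\mathcal R_n$-submodule of $\mathcal R_n\times\mathcal R_n$ generated by $(1,g)$. A linear code $C\subseteq F^n\times F^n$ is called $2$-quasi-cyclic if $(c_0,\dots,c_{n-1},c'_0,\dots,c'_{n-1})\in C$ implies $(c_{n-1},c_0,\dots,c_{n-2},c'_{n-1},c'_0,\dots,c'_{n-2})\in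 C$. It is called Hermitian self-dual if $C=\{a\in F^{2n} : \sum_{j} c_j a_j^{p^{\ell/2}}=0 \text{ for all } c\in C\}$. Its rate is $\mathrm R(C)=\dim_F C/(2n)$, and its relative minimum distance is $\Delta(C)=d(C)/(2n)$, where $d(C)$ is the minimum Hamming distance between distinct codewords of $C$. Then there are integers $n_i>1$ coprime to $q$ and elements $g_i\in\mathcal R_{n_i}$ with $g_ig_i^*=-1$ $(i=1,2,\dots)$ such that $2n_i\to\infty$ as $i\to\infty$ and, for every $i$, the code $C_i=C_{1,g_i}$ of length $2n_i$ is a Hermitian self-dual $2$-quasi-cyclic code over $F$, with $\mathrm R(C_i)=\tfrac12$ and $\Delta(C_i)>\delta$. -/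

import Mathlib

open Polynomial

/-- The `q`-entropy function
`h_q(δ) = δ log_q (q-1) - δ log_q δ - (1-δ) log_q (1-δ)`. -/
noncomputable def qEntropy (q : ℕ) (δ : ℝ) : ℝ :=
  δ * Real.logb q (q - 1) - δ * Real.logb q δ - (1 - δ) * Real.logb q (1 - δ)

section Codes

variable {F : Type*} [Field F] {ι : Type*} [Fintype ι]

/-- The minimum distance of a code: the least Hamming distance of two distinct codewords. -/
noncomputable def minDistance [DecidableEq F] (C : Submodule F (ι → F)) : ℕ :=
  sInf {d | ∃ c ∈ C, ∃ c' ∈ C, c ≠ c' ∧ hammingDist c c' = d}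

/-- The relative minimum distance `Δ(C)`: minimum distance divided by code length. -/
noncomputable def relMinDistance [DecidableEq F] (C : Submodule F (ι → F)) : ℝ :=
  (minDistance C : ℝ) / (Fintype.card ι : ℝ)

/-- The rate `R(C)`: dimension divided by code length. -/
noncomputable def codeRate (C : Submodule F (ι → F)) : ℝ :=
  (Module.finrank F C : ℝ) / (Fintype.card ι : ℝ)

/-- The Galois `p^h`-inner product `∑ aᵢ bᵢ^(p^h)`. -/
def galoisInner (p h : ℕ) (a b : ι → F) : F :=
  ∑ i, a i * b i ^ p ^ h

/-- The Galois `p^h`-dual code of `C`. -/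
def galoisDual (p h : ℕ) (C : Submodule F (ι → F)) : Set (ι → F) :=
  {a | ∀ c ∈ C, galoisInner p h c a = 0}

/-- `C` is Galois `p^h`-self-dual. -/
def IsGaloisSelfDual (p h : ℕ) (C : Submodule F (ι → F)) : Prop :=
  (C : Set (ι → F)) = galoisDual p h C

/-- A code over the field with `p^l` elements, `l` even, is Hermitian self-dual if it is Galois
`p^(l/2)`-self-dual. -/
def IsHermitianSelfDual (p l : ℕ) (C : Submodule F (ι → F)) : Prop :=
  IsGaloisSelfDual p (l / 2) C

/-- The double cyclic permutation
`(c₀, …, cₙ₋₁, c'₀, …, c'ₙ₋₁) ↦ (cₙ₋₁, c₀, …, cₙ₋₂, c'ₙ₋₁, c'₀, …, c'ₙ₋₂)` on `F^n × F^n`, whose words are indexed by `Fin n ⊕ Fin n`. -/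
def doubleShift {n : ℕ} (c : Fin n ⊕ Fin n → F) : Fin n ⊕ Fin n → F :=
  Sum.elim (fun i => c (Sum.inl ((finRotate n).symm i)))
    (fun i => c (Sum.inr ((finRotate n).symm i)))

/-- A linear code in `F^n × F^n` is 2-quasi-cyclic if it is invariant under the double cyclic
permutation. -/
def IsTwoQuasiCyclic {n : ℕ} (C : Submodule F (Fin n ⊕ Fin n → F)) : Prop :=
  ∀ c ∈ C, doubleShift c ∈ C

end Codes

section CyclicAlgebra

/-- The algebra `F[X] / (X^n - 1)`. -/
abbrev CycAlg (F : Type*) [Field F] (n : ℕ) : Type _ :=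
  AdjoinRoot (X ^ n - 1 : F[X])

variable {F : Type*} [Field F]

/-- The class of `X` in `F[X] / (X^n - 1)`. -/
noncomputable abbrev CycAlg.x (F : Type*) [Field F] (n : ℕ) : CycAlg F n :=
  AdjoinRoot.root (X ^ n - 1 : F[X])

theorem CycAlg.x_pow (n : ℕ) : CycAlg.x F n ^ n = 1 := by
  have h : AdjoinRoot.mk (X ^ n - 1 : F[X]) (X ^ n - 1) = 0 := AdjoinRoot.mk_self
  rw [map_sub, map_pow, map_one, AdjoinRoot.mk_X] at h
  exact sub_eq_zero.mp h

/-- The identification `(a₀, …, aₙ₋₁) ↦ a₀ + a₁ X + ⋯ + aₙ₋₁ X^(n-1)` of `F^n` with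
`F[X] / (X^n - 1)` (bijective for `n ≥ 1`). -/
noncomputable def wordToCyc (F : Type*) [Field F] (n : ℕ) : (Fin n → F) →ₗ[F] CycAlg F n :=
  Fintype.linearCombination F (fun i : Fin n => CycAlg.x F n ^ (i : ℕ))

/-- The identification of `F^n × F^n` with the square of `F[X] / (X^n - 1)`, componentwise. -/
noncomputable def wordToCycPair (F : Type*) [Field F] (n : ℕ) :
    (Fin n ⊕ Fin n → F) →ₗ[F] CycAlg F n × CycAlg F n :=
  (wordToCyc F n ∘ₗ LinearMap.funLeft F F Sum.inl).prod
    (wordToCyc F n ∘ₗ LinearMap.funLeft F F Sum.inr)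

/-- The code `C_{a,b}` in `F^n × F^n`: the words that correspond to the elements of the
`F[X] / (X^n - 1)`-submodule of `(F[X] / (X^n - 1))²` generated by `(a, b)`. -/
noncomputable def pairCode {n : ℕ} (a b : CycAlg F n) : Submodule F (Fin n ⊕ Fin n → F) :=
  ((Submodule.span (CycAlg F n) {(a, b)}).restrictScalars F).comap (wordToCycPair F n)

/-- The operator `*` on `F[X] / (X^n - 1)`, `∑ aᵢ X^i ↦ ∑ aᵢ^(p^h) X^((n-1)i)`
(see `cycStar_wordToCyc`). -/
noncomputable def cycStar (p h : ℕ) [Fact p.Prime] [CharP F p] (n : ℕ) :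
    CycAlg F n →+* CycAlg F n :=
  AdjoinRoot.lift ((AdjoinRoot.of (X ^ n - 1 : F[X])).comp (iterateFrobenius F p h))
    (CycAlg.x F n ^ (n - 1)) (by
      rw [eval₂_sub, eval₂_pow, eval₂_X, eval₂_one, ← pow_mul, mul_comm, pow_mul,
        CycAlg.x_pow, one_pow, sub_self])

theorem cycStar_wordToCyc (p h : ℕ) [Fact p.Prime] [CharP F p] (n : ℕ) (a : Fin n → F) :
    cycStar p h n (wordToCyc F n a) =
      ∑ i : Fin n, (a i ^ p ^ h) • CycAlg.x F n ^ ((n - 1) * (i : ℕ)) := by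
  simp only [wordToCyc, Fintype.linearCombination_apply, map_sum, Algebra.smul_def,
    AdjoinRoot.algebraMap_eq, map_mul, map_pow, cycStar, AdjoinRoot.lift_of, AdjoinRoot.lift_root,
    RingHom.comp_apply, iterateFrobenius_def, pow_mul]

end CyclicAlgebra

/-! The proof is a counting argument over D = {g : g g* = -1}. Write R = F[X]/(X^n-1), σ for the
star, and h for the entropy of δ. For g in D the code of (1,g) is automatically self-dual of rate
1/2 (`isGaloisSelfDual_pairCode`, `codeRate_pairCode`), so it suffices to find a g in D whose code
has no light nonzero word.

Suppose (u, v) with v = ug is such a word. The ideal generated by u and σ(u) is eR for a σ-invariant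
idempotent e, and both u and v lie in eR. Two estimates bound the number of g that are bad because
of a given e: - eR × eR contains at most n|eR|^(2h) light pairs, because eR is invariant under
cyclic shifts (`card_light_pairs_le`); - each pair (u, v) is hit by at most 2|D|/√|eR| elements g.
These g lie in a coset of the stabiliser of e among the elements of norm one, and that stabiliser is
small by a Hilbert 90 style count (`card_filter_mul_eq_le`, `card_stab_sq_mul_le`).

So e accounts for at most 2n|D||eR|^(2h-1/2) bad elements, and the exponent is negative since h <
1/4. If n is prime, every residue field of R except the one at x = 1 has at least B = q^(ord_n q)
elements, so |eR| ≥ B^k when e is supported on k such fields. The case k = 0 gives only words of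
weight 2n, which are not light. Summing over e (`sum_pow_card_le`) bounds the bad fraction by
8n²B^(2h-1/2).

This is less than 1 once B exceeds a large power of n. Arbitrarily large primes n with this property
exist, since otherwise all large primes up to Y would divide a product of numbers q^t-1 too small to
accommodate them (`exists_prime_pow_le_pow_orderOf`). -/

/-! ### Primes modulo which q has large order. -/

/-- A prime n modulo which q has order t < T divides q^t-1. Hence the product of all primes in (N,
Y] divides the product of the q^t-1 with 1 ≤ t < T, which is at most q^(T·T). -/
theorem primorial_le_of_orderOf_lt {q N Y T : ℕ} (hq : 2 ≤ q) (hqN : q ≤ N) (hNY : N ≤ Y)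
    (h : ∀ n, n.Prime → N < n → n ≤ Y → orderOf (q : ZMod n) < T) :
    primorial Y ≤ primorial N * q ^ (T * T) := by
  have hP : ∏ t ∈ Finset.Ico 1 T, (q ^ t - 1) ≤ q ^ (T * T) := by
    calc ∏ t ∈ Finset.Ico 1 T, (q ^ t - 1) ≤ ∏ t ∈ Finset.Ico 1 T, q ^ T := by
          refine Finset.prod_le_prod' fun t ht => ?_
          exact (Nat.sub_le _ _).trans
            (Nat.pow_le_pow_right (by omega) (Finset.mem_Ico.1 ht).2.le)
      _ ≤ q ^ (T * T) := by
          rw [Finset.prod_const, ← pow_mul, Nat.card_Ico]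
          exact Nat.pow_le_pow_right (by omega) (Nat.mul_le_mul_left _ (Nat.sub_le _ _))
  have hPpos : 0 < ∏ t ∈ Finset.Ico 1 T, (q ^ t - 1) := by
    refine Finset.prod_pos fun t ht => Nat.sub_pos_of_lt ?_
    exact Nat.one_lt_pow (by have := Finset.mem_Ico.1 ht; omega) (by omega)
  have hdvd : (∏ n ∈ (Finset.Ioc N Y).filter Nat.Prime, n) ∣ ∏ t ∈ Finset.Ico 1 T, (q ^ t - 1) := by
    refine Finset.prod_primes_dvd _ (fun n hn => (Finset.mem_filter.1 hn).2.prime) fun n hn => ?_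
    obtain ⟨hn1, hn2⟩ := Finset.mem_filter.1 hn
    obtain ⟨hn3, hn4⟩ := Finset.mem_Ioc.1 hn1
    have : Fact n.Prime := ⟨hn2⟩
    have hq0 : (q : ZMod n) ≠ 0 := by
      rw [Ne, ZMod.natCast_eq_zero_iff]
      exact fun hd => absurd (Nat.le_of_dvd (by omega) hd) (by omega)
    have hpos : 0 < orderOf (q : ZMod n) := by
      have := orderOf_pos (Units.mk0 _ hq0)
      rwa [← orderOf_units] at this
    refine dvd_trans ?_ (Finset.dvd_prod_of_mem _ (Finset.mem_Ico.2 ⟨hpos, h n hn2 hn3 hn4⟩))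
    rw [← ZMod.natCast_eq_zero_iff, Nat.cast_sub (Nat.one_le_pow _ _ (by omega))]
    simp [pow_orderOf_eq_one]
  have hsplit : primorial Y = primorial N * ∏ n ∈ (Finset.Ioc N Y).filter Nat.Prime, n := by
    have hu : (Finset.range (Y + 1)).filter Nat.Prime =
        (Finset.range (N + 1)).filter Nat.Prime ∪ (Finset.Ioc N Y).filter Nat.Prime := by
      ext n
      simp only [Finset.mem_filter, Finset.mem_union, Finset.mem_range, Finset.mem_Ioc]
      constructor
      · rintro ⟨h1, h2⟩
        by_cases hc : n < N + 1
        · exact Or.inl ⟨hc, h2⟩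
        · exact Or.inr ⟨⟨by omega, by omega⟩, h2⟩
      · rintro (⟨h1, h2⟩ | ⟨h1, h2⟩) <;> exact ⟨by omega, h2⟩
    have hd : Disjoint ((Finset.range (N + 1)).filter Nat.Prime)
        ((Finset.Ioc N Y).filter Nat.Prime) := by
      rw [Finset.disjoint_left]
      intro n h1 h2
      simp only [Finset.mem_filter, Finset.mem_range, Finset.mem_Ioc] at h1 h2
      omega
    rw [primorial, hu, Finset.prod_union hd]
    rfl
  rw [hsplit]
  exact Nat.mul_le_mul_left _ ((Nat.le_of_dvd hPpos hdvd).trans hP)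

/-- If this failed, all primes n in (N, Y] would have order O(log Y). The primorial bound would then
give θ(Y) = O(log² Y), against Chebyshev's linear lower bound. -/
theorem exists_prime_pow_le_pow_orderOf {q : ℕ} (hq : 2 ≤ q) (A N : ℕ) :
    ∃ n, n.Prime ∧ N < n ∧ n ^ A ≤ q ^ orderOf (q : ZMod n) := by
  by_contra! hcon
  -- Primes above M also exceed q, so q is invertible modulo them.
  set M := max N q
  have hY : ∀ Y : ℕ, M ≤ Y →
      primorial Y ≤ primorial M * q ^ ((A * (Nat.log 2 Y + 1)) * (A * (Nat.log 2 Y + 1))) := by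
    intro Y hMY
    refine primorial_le_of_orderOf_lt hq (le_max_right _ _) hMY fun n hn hMn hnY => ?_
    have h1 := hcon n hn (lt_of_le_of_lt (le_max_left _ _) hMn)
    have h2 : n ^ A ≤ q ^ (A * (Nat.log 2 Y + 1)) := by
      rw [mul_comm, pow_mul]
      refine Nat.pow_le_pow_left (hnY.trans ?_) _
      exact (Nat.lt_pow_succ_log_self (by norm_num) Y).le.trans (Nat.pow_le_pow_left hq _)
    exact (Nat.pow_lt_pow_iff_right (by omega)).1 (h1.trans_le h2)
  have hlogq : 0 < Real.log q := Real.log_pos (by exact_mod_cast hq)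
  have hlog2 : 0 < Real.log 2 := Real.log_pos (by norm_num)
  have hbound : ∀ Y : ℕ, M ≤ Y → 1 ≤ Y → (Y : ℝ) * Real.log 2 ≤
      Real.log (Y + 1) + 2 * √Y * Real.log Y + Real.log (primorial M) +
      A ^ 2 * Real.log q * (Real.log Y / Real.log 2 + 1) ^ 2 := by
    intro Y hMY hY1
    have h1 := Chebyshev.theta_ge Y
    rw [Chebyshev.theta_eq_log_primorial, Nat.floor_natCast] at h1
    have h2 : Real.log (primorial Y) ≤ Real.log (primorial M) +
        ((A * (Nat.log 2 Y + 1)) * (A * (Nat.log 2 Y + 1)) : ℕ) * Real.log q := by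
      rw [← Real.log_pow, ← Real.log_mul (by exact_mod_cast (primorial_pos M).ne') (by positivity)]
      refine Real.log_le_log (by exact_mod_cast primorial_pos Y) ?_
      exact_mod_cast hY Y hMY
    have h3 : (Nat.log 2 Y : ℝ) ≤ Real.log Y / Real.log 2 := by
      rw [le_div_iff₀ hlog2, ← Real.log_pow]
      refine Real.log_le_log (by positivity) ?_
      exact_mod_cast Nat.pow_log_le_self 2 (by omega)
    have h4 : (((A * (Nat.log 2 Y + 1)) * (A * (Nat.log 2 Y + 1)) : ℕ) : ℝ) * Real.log q ≤
        A ^ 2 * Real.log q * (Real.log Y / Real.log 2 + 1) ^ 2 := by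
      have : ((Nat.log 2 Y : ℝ) + 1) ^ 2 ≤ (Real.log Y / Real.log 2 + 1) ^ 2 := by gcongr
      push_cast
      calc _ = A ^ 2 * Real.log q * ((Nat.log 2 Y : ℝ) + 1) ^ 2 := by ring
        _ ≤ _ := by gcongr
    linarith
  -- The right-hand side of `hbound` is o(Y), whereas its left-hand side is Y log 2.
  have hlo : (fun Y : ℝ => Real.log (Y + 1) + 2 * √Y * Real.log Y + Real.log (primorial M) +
      A ^ 2 * Real.log q * (Real.log Y / Real.log 2 + 1) ^ 2) =o[Filter.atTop] fun Y : ℝ => Y := by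
    have hlog : Real.log =o[Filter.atTop] fun Y : ℝ => Y := Real.isLittleO_log_id_atTop
    have hc : ∀ c : ℝ, (fun _ : ℝ => c) =o[Filter.atTop] fun Y : ℝ => Y :=
      fun c => Asymptotics.isLittleO_const_id_atTop c
    have hl4 : Real.log =o[Filter.atTop] fun Y : ℝ => Y ^ (1 / 2 : ℝ) :=
      isLittleO_log_rpow_atTop (by norm_num)
    have hl1 : (fun _ : ℝ => (1 : ℝ)) =o[Filter.atTop] fun Y : ℝ => Y ^ (1 / 2 : ℝ) :=
      (Asymptotics.isLittleO_one_left_iff ℝ).2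
        (Filter.tendsto_abs_atTop_atTop.comp (tendsto_rpow_atTop (by norm_num)))
    have hhalf : (fun Y : ℝ => Y ^ (1 / 2 : ℝ) * Y ^ (1 / 2 : ℝ)) =ᶠ[Filter.atTop] fun Y => Y := by
      filter_upwards [Filter.eventually_gt_atTop 0] with Y hY
      rw [← Real.rpow_add hY]; norm_num
    refine ((Asymptotics.IsLittleO.add (Asymptotics.IsLittleO.add ?_ ?_) (hc _)).add ?_)
    · have h1 : (fun Y : ℝ => Real.log (Y + 1)) =o[Filter.atTop] fun Y : ℝ => Y + 1 :=
        hlog.comp_tendsto (Filter.tendsto_atTop_add_const_right _ 1 Filter.tendsto_id)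
      refine h1.trans_isBigO ?_
      exact (Asymptotics.isBigO_refl _ _).add (hc 1).isBigO
    · have h1 : (fun Y : ℝ => (2 * √Y) * Real.log Y) =o[Filter.atTop]
          fun Y : ℝ => Y ^ (1 / 2 : ℝ) * Y ^ (1 / 2 : ℝ) := by
        refine Asymptotics.IsBigO.mul_isLittleO ?_ hl4
        simp only [Real.sqrt_eq_rpow]
        exact (Asymptotics.isBigO_refl _ _).const_mul_left 2
      exact h1.trans_eventuallyEq hhalf
    · have h1 : (fun Y : ℝ => Real.log Y / Real.log 2 + 1) =o[Filter.atTop]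
          fun Y : ℝ => Y ^ (1 / 2 : ℝ) := by
        refine Asymptotics.IsLittleO.add ?_ hl1
        exact (hl4.const_mul_left (Real.log 2)⁻¹).congr_left fun Y => (div_eq_inv_mul _ _).symm
      have h2 := (h1.mul h1).trans_eventuallyEq hhalf
      simp only [← pow_two] at h2
      exact h2.const_mul_left _
  have hev := (hlo.comp_tendsto tendsto_natCast_atTop_atTop).bound (half_pos hlog2)
  obtain ⟨Y, hY1, hY2, hY3⟩ := (hev.and ((Filter.eventually_ge_atTop M).and
    (Filter.eventually_ge_atTop 1))).exists
  have h1 := hbound Y hY2 hY3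
  simp only [Function.comp, Real.norm_eq_abs, Nat.abs_cast] at hY1
  have h2 := (le_abs_self _).trans hY1
  have h3 : (0 : ℝ) < Y := by exact_mod_cast hY3
  nlinarith

/-! ### Idempotents of reduced Artinian rings. -/

section Idempotents

variable {R : Type*} [CommRing R]

theorem one_sub_mem_of_notMem {e : R} (he : e * e = e) {m : Ideal R} [hm : m.IsPrime]
    (hem : e ∉ m) : 1 - e ∈ m := by
  have h : e * (1 - e) ∈ m := by
    rw [show e * (1 - e) = 0 by linear_combination -he]; exact m.zero_mem
  exact (hm.mem_or_mem h).resolve_left hem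

theorem eq_of_forall_mem_maximal_iff [IsArtinianRing R] [IsReduced R] {e e' : R} (he : e * e = e) (he' : e' * e' = e')
    (h : ∀ m : MaximalSpectrum R, e ∈ m.asIdeal ↔ e' ∈ m.asIdeal) : e = e' := by
  apply (IsArtinianRing.equivPi R).injective
  funext m
  rw [IsArtinianRing.equivPi_apply, IsArtinianRing.equivPi_apply]
  refine Ideal.Quotient.eq.2 ?_
  have := m.isMaximal.isPrime
  by_cases hem : e ∈ m.asIdeal
  · exact m.asIdeal.sub_mem hem ((h m).1 hem)
  · rw [show e - e' = (1 - e') - (1 - e) by ring]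
    exact m.asIdeal.sub_mem (one_sub_mem_of_notMem he' (fun h' => hem ((h m).2 h')))
      (one_sub_mem_of_notMem he hem)

/-- In a reduced Artinian ring with an involution, the ideal generated by `a` and `σ a` is generated
by an invariant idempotent. -/
theorem exists_invariant_idempotent [IsArtinianRing R] [IsReduced R] {σ : R →+* R} (hσ : ∀ r, σ (σ r) = r) (a : R) :
    ∃ e c : R, e * e = e ∧ σ e = e ∧ e * a = a ∧
      e = a * c + σ (a * c) - a * c * σ (a * c) := by
  let : ∀ m : MaximalSpectrum R, Field (R ⧸ m.asIdeal) := fun m =>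
    Ideal.Quotient.field m.asIdeal
  set φ := IsArtinianRing.equivPi R
  -- In the product of residue fields c is the pointwise inverse of a, with 0⁻¹ = 0. So f = ac is
  -- the idempotent generating (a), and e = f + σf - fσf is the join of f and σf.
  obtain ⟨c, hc⟩ := φ.surjective fun m => (φ a m)⁻¹
  have hac : a * c * a = a := by
    apply φ.injective
    rw [map_mul, map_mul, hc]
    funext m
    simp only [Pi.mul_apply]
    exact mul_inv_mul_cancel (φ a m)
  refine ⟨a * c + σ (a * c) - a * c * σ (a * c), c, ?_, ?_, ?_, rfl⟩
  · have hf : (a * c) * (a * c) = a * c := by linear_combination c * hac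
    have hσf := congrArg σ hf
    rw [map_mul] at hσf
    set f := a * c
    linear_combination (1 - 2 * σ f + σ f * σ f) * hf + (1 - f) * hσf
  · rw [map_sub, map_add, map_mul σ (a * c), hσ]; ring
  · linear_combination (1 - σ (a * c)) * hac

end Idempotents

/-! ### Counting elements of given norm in a finite ring with involution. -/

section Involution

variable {R : Type*} [CommRing R] [Fintype R] [DecidableEq R] (σ : R →+* R)

/-- The elements `u` with `u * σ u = c`. -/
def normFiber (c : R) : Finset R := Finset.univ.filter fun u => u * σ u = c

/-- The elements of the ideal generated by an idempotent `e`. -/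
def corner (e : R) : Finset R := Finset.univ.filter fun w => e * w = w

variable {σ}

theorem mem_normFiber {c u : R} : u ∈ normFiber σ c ↔ u * σ u = c := by simp [normFiber]

theorem mem_corner {e w : R} : w ∈ corner e ↔ e * w = w := by simp [corner]

/-- Since σ e = e, the splitting R = eR × (1-e)R respects norms. A norm-one u with ue = e is
determined by its part in (1-e)R, and its part in eR may be replaced by any v of norm e. -/
theorem card_stab_mul_le {e : R} (he : e * e = e) (hσe : σ e = e) :
    ((normFiber σ 1).filter fun u => u * e = e).card *
      ((corner e).filter fun v => v * σ v = e).card ≤ (normFiber σ 1).card := by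
  rw [← Finset.card_product]
  refine Finset.card_le_card_of_injOn (fun x => x.2 + (1 - e) * x.1) ?_ ?_
  · rintro ⟨u, v⟩ h
    simp only [Finset.coe_product, Set.mem_prod, Finset.mem_coe, Finset.mem_filter, mem_normFiber,
      mem_corner] at h
    obtain ⟨⟨h1, h2⟩, h3, h4⟩ := h
    have h3' : e * σ v = σ v := by rw [← hσe, ← map_mul, h3]
    simp only [Finset.mem_coe, mem_normFiber, map_add, map_mul, map_sub, map_one, hσe]
    linear_combination h4 + (1 - e) * h1 + (u * σ u) * he - (1 - e) * σ u * h3 +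
      (e - 1) * u * h3' + (- σ u * v - u * σ v) * he
  · rintro ⟨u, v⟩ h ⟨u', v'⟩ h' heq
    simp only [Finset.coe_product, Set.mem_prod, Finset.mem_coe, Finset.mem_filter, mem_normFiber,
      mem_corner] at h h' heq
    obtain ⟨⟨h1, h2⟩, h3, h4⟩ := h
    obtain ⟨⟨h1', h2'⟩, h3', h4'⟩ := h'
    have hv : v = v' := by
      linear_combination e * heq - h3 + h3' + (u - u') * he
    have hu : u = u' := by
      linear_combination heq - hv + h2 - h2'
    rw [hu, hv]

/-- Symmetric elements form at most a "half" of eR: (s, t) ↦ s + θt is injective on symmetric pairs,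
as applying σ and subtracting isolates (σθ - θ)t. -/
theorem card_symm_sq_le {θ : R} (hθ : IsUnit (σ θ - θ)) {e : R} :
    ((corner e).filter fun s => σ s = s).card ^ 2 ≤ (corner e).card := by
  rw [pow_two, ← Finset.card_product]
  refine Finset.card_le_card_of_injOn (fun x => x.1 + θ * x.2) ?_ ?_
  · rintro ⟨s, t⟩ h
    simp only [Finset.coe_product, Set.mem_prod, Finset.mem_coe, Finset.mem_filter,
      mem_corner] at h ⊢
    linear_combination h.1.1 + θ * h.2.1
  · rintro ⟨s, t⟩ h ⟨s', t'⟩ h' heq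
    simp only [Finset.coe_product, Set.mem_prod, Finset.mem_coe, Finset.mem_filter,
      mem_corner] at h h' heq
    have h1 := congrArg σ heq
    simp only [map_add, map_mul, h.1.2, h.2.2, h'.1.2, h'.2.2] at h1
    have ht : t = t' := by
      refine hθ.mul_left_cancel ?_
      linear_combination h1 - heq
    have hs : s = s' := by rw [ht] at heq; exact add_right_cancel heq
    rw [hs, ht]

/-- The Hilbert 90 map w ↦ w/σ(w) sends units of eR to elements of norm e. Two units in the same
fibre have a symmetric quotient, so fibres are no larger than the set of symmetric elements. Units
of eR are encoded by invertibility of w + (1-e) in R. -/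
theorem card_units_le (hσ : ∀ r, σ (σ r) = r) {e : R} (he : e * e = e) (hσe : σ e = e) :
    ((corner e).filter fun w => IsUnit (w + (1 - e))).card ≤
      ((corner e).filter fun s => σ s = s).card *
        ((corner e).filter fun v => v * σ v = e).card := by
  have hinv : ∀ w : R, IsUnit (w + (1 - e)) →
      σ (w + (1 - e)) * Ring.inverse (σ (w + (1 - e))) = 1 :=
    fun w hw => Ring.mul_inverse_cancel _ (hw.map σ)
  set f : R → R := fun w => w * Ring.inverse (σ (w + (1 - e)))
  refine (Finset.card_le_mul_card_image (f := f) _ _ ?_).trans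
    (Nat.mul_le_mul_left _ (Finset.card_le_card ?_))
  · intro v hv
    obtain ⟨w₀, hw₀, rfl⟩ := Finset.mem_image.1 hv
    obtain ⟨hw₀1, hw₀2⟩ := Finset.mem_filter.1 hw₀
    have hu₀ : (w₀ + (1 - e)) * Ring.inverse (w₀ + (1 - e)) = 1 := Ring.mul_inverse_cancel _ hw₀2
    set i₀ := Ring.inverse (w₀ + (1 - e)) with hi₀
    have hj₀ := hinv w₀ hw₀2
    rw [mem_corner] at hw₀1
    have hi₀j : σ i₀ = Ring.inverse (σ (w₀ + (1 - e))) := by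
      have h1 := congrArg σ hu₀
      rw [map_mul, map_one] at h1
      linear_combination Ring.inverse (σ (w₀ + (1 - e))) * h1 - σ i₀ * hj₀
    refine Finset.card_le_card_of_injOn (fun w => w * i₀) ?_ ?_
    · intro w hw
      simp only [Finset.coe_filter, Finset.mem_filter, Set.mem_ofPred_eq, mem_corner] at hw
      obtain ⟨⟨hw1, hw2⟩, hw3⟩ := hw
      simp only [Finset.coe_filter, Set.mem_ofPred_eq, mem_corner]
      refine ⟨by linear_combination i₀ * hw1, ?_⟩
      have hj := hinv w hw2
      simp only [f] at hw3
      rw [map_mul, hi₀j]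
      set j := Ring.inverse (σ (w + (1 - e)))
      set j₀ := Ring.inverse (σ (w₀ + (1 - e)))
      simp only [map_add, map_sub, map_one, hσe] at hj hj₀ hu₀
      have hσw : e * σ w = σ w := by rw [← hσe, ← map_mul, hw1]
      have e1 : w = w₀ * j₀ * σ w := by
        linear_combination -w * hj - j * hw1 + σ w * hw3
      have e2 : w₀ * i₀ = e := by
        linear_combination e * hu₀ - i₀ * hw₀1 + i₀ * he
      linear_combination -i₀ * e1 - j₀ * σ w * e2 - j₀ * hσw
    · intro w hw w' hw' heq
      have hi : IsUnit i₀ := IsUnit.of_mul_eq_one _ (by rw [mul_comm]; exact hu₀)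
      exact hi.mul_right_cancel heq
  · intro v hv
    obtain ⟨w, hw, rfl⟩ := Finset.mem_image.1 hv
    simp only [Finset.mem_filter, mem_corner] at hw ⊢
    obtain ⟨hw1, hw2⟩ := hw
    refine ⟨by simp only [f]; linear_combination Ring.inverse (σ (w + (1 - e))) * hw1, ?_⟩
    have hj := hinv w hw2
    have hi : (w + (1 - e)) * Ring.inverse (w + (1 - e)) = 1 := Ring.mul_inverse_cancel _ hw2
    simp only [f]
    rw [map_mul]
    set j := Ring.inverse (σ (w + (1 - e)))
    set i := Ring.inverse (w + (1 - e))
    have hσj : σ j = i := by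
      have h1 := congrArg σ hj
      rw [map_mul, map_one, hσ] at h1
      linear_combination i * h1 - σ j * hi
    simp only [map_add, map_sub, map_one, hσe] at hj
    have hσw : e * σ w = σ w := by rw [← hσe, ← map_mul, hw1]
    have e1 : w * i = e := by linear_combination e * hi - i * hw1 + i * he
    have e2 : σ w * j = e := by linear_combination e * hj - j * hσw + j * he
    rw [hσj]
    linear_combination σ w * j * e1 + e * e2 + he

/-- When e ∉ m, e is congruent to 1 modulo m, so eR maps onto R/m with kernel eR ∩ m. -/
theorem card_corner_inter_mul_le {e : R} (he : e * e = e) {m : Ideal R} [hm : m.IsPrime]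
    (hem : e ∉ m) [Fintype (R ⧸ m)] [DecidablePred (· ∈ m)] :
    ((corner e).filter (· ∈ m)).card * Fintype.card (R ⧸ m) ≤ (corner e).card := by
  rw [← Finset.card_univ, ← Finset.card_product]
  have h1 : ∀ w, Ideal.Quotient.mk m (e * w) = Ideal.Quotient.mk m w := by
    intro w
    rw [Ideal.Quotient.eq, show e * w - w = - (w * (1 - e)) by ring]
    exact m.neg_mem (m.mul_mem_left _ (one_sub_mem_of_notMem he hem))
  refine Finset.card_le_card_of_injOn (fun x => x.1 + e * Quotient.out x.2) ?_ ?_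
  · rintro ⟨w, y⟩ h
    simp only [Finset.coe_product, Set.mem_prod, Finset.mem_coe, Finset.mem_filter,
      mem_corner] at h ⊢
    linear_combination h.1.1 + Quotient.out y * he
  · rintro ⟨w, y⟩ h ⟨w', y'⟩ h' heq
    simp only [Finset.coe_product, Set.mem_prod, Finset.mem_coe, Finset.mem_filter,
      mem_corner] at h h' heq
    have h2 := congrArg (Ideal.Quotient.mk m) heq
    have h3 : ∀ z : R ⧸ m, Ideal.Quotient.mk m (Quotient.out z) = z := fun z => Quotient.out_eq z
    rw [map_add, map_add, h1, h1, h3, h3, Ideal.Quotient.eq_zero_iff_mem.2 h.1.2,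
      Ideal.Quotient.eq_zero_iff_mem.2 h'.1.2, zero_add, zero_add] at h2
    subst h2
    rw [add_right_cancel heq]

open scoped Classical in
-- A non-unit of eR lies in some maximal ideal m with e ∉ m. Each such m contains at most a fraction
-- 1/|R/m| of eR, so a union bound leaves at least half of eR as units.
theorem card_corner_le_two_mul_units [∀ m : Ideal R, Fintype (R ⧸ m)] [Fintype (MaximalSpectrum R)]
    (hsum : ∑ m : MaximalSpectrum R, (Fintype.card (R ⧸ m.asIdeal) : ℝ)⁻¹ ≤ 1 / 2)
    {e : R} (he : e * e = e) :
    (corner e).card ≤ 2 * ((corner e).filter fun w => IsUnit (w + (1 - e))).card := by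
  set T := Finset.univ.filter fun m : MaximalSpectrum R => e ∉ m.asIdeal
  have hsub : (corner e).filter (fun w => ¬ IsUnit (w + (1 - e))) ⊆
      T.biUnion fun m => (corner e).filter (· ∈ m.asIdeal) := by
    intro w hw
    obtain ⟨hw1, hw2⟩ := Finset.mem_filter.1 hw
    obtain ⟨m, hm, hwm⟩ := exists_max_ideal_of_mem_nonunits hw2
    have hem : e ∉ m := by
      intro hem
      have hwm' : w ∈ m := by
        rw [← mem_corner.1 hw1]; exact m.mul_mem_right _ hem
      refine hm.ne_top ((Ideal.eq_top_iff_one m).2 ?_)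
      have := m.add_mem (m.sub_mem hwm hwm') hem
      rwa [show w + (1 - e) - w + e = 1 by ring] at this
    refine Finset.mem_biUnion.2 ⟨⟨m, hm⟩, by simpa [T] using hem, Finset.mem_filter.2 ⟨hw1, ?_⟩⟩
    have := m.sub_mem hwm (one_sub_mem_of_notMem (hm := hm.isPrime) he hem)
    rwa [add_sub_cancel_right] at this
  have hle : (((corner e).filter (fun w => ¬ IsUnit (w + (1 - e)))).card : ℝ) ≤
      (corner e).card * (1 / 2) := by
    calc (((corner e).filter (fun w => ¬ IsUnit (w + (1 - e)))).card : ℝ)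
        ≤ ∑ m ∈ T, (((corner e).filter (· ∈ m.asIdeal)).card : ℝ) := by
          exact_mod_cast (Finset.card_le_card hsub).trans Finset.card_biUnion_le
      _ ≤ ∑ m ∈ T, (corner e).card * (Fintype.card (R ⧸ m.asIdeal) : ℝ)⁻¹ := by
          refine Finset.sum_le_sum fun m hm => ?_
          have hpos : (0 : ℝ) < Fintype.card (R ⧸ m.asIdeal) := by exact_mod_cast Fintype.card_pos
          rw [← div_eq_mul_inv, le_div_iff₀ hpos]
          have := m.isMaximal.isPrime
          exact_mod_cast card_corner_inter_mul_le he (by simpa [T] using hm)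
      _ = (corner e).card * ∑ m ∈ T, (Fintype.card (R ⧸ m.asIdeal) : ℝ)⁻¹ := by
          rw [Finset.mul_sum]
      _ ≤ (corner e).card * (1 / 2) := by
          refine mul_le_mul_of_nonneg_left (le_trans ?_ hsum) (by positivity)
          exact Finset.sum_le_sum_of_subset_of_nonneg (Finset.subset_univ _)
            fun _ _ _ => by positivity
  have hadd := Finset.card_filter_add_card_filter_not (s := corner e)
    (fun w => IsUnit (w + (1 - e)))
  have : (((corner e).filter (fun w => IsUnit (w + (1 - e)))).card : ℝ) +
    ((corner e).filter (fun w => ¬ IsUnit (w + (1 - e)))).card = (corner e).card := by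
    exact_mod_cast hadd
  have h3 : ((corner e).card : ℝ) ≤
      2 * ((corner e).filter fun w => IsUnit (w + (1 - e))).card := by linarith
  exact_mod_cast h3

/-- Let E = |eR|, and let S and V count the symmetric elements and those of norm e in eR. Then E ≤
2SV and S² ≤ E give E ≤ 4V², while the stabiliser has at most 1/V of all norm-one elements. -/
theorem card_stab_sq_mul_le (hσ : ∀ r, σ (σ r) = r) {θ : R} (hθ : IsUnit (σ θ - θ))
    [∀ m : Ideal R, Fintype (R ⧸ m)] [Fintype (MaximalSpectrum R)]
    (hsum : ∑ m : MaximalSpectrum R, (Fintype.card (R ⧸ m.asIdeal) : ℝ)⁻¹ ≤ 1 / 2)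
    {e : R} (he : e * e = e) (hσe : σ e = e) :
    ((normFiber σ 1).filter fun u => u * e = e).card ^ 2 * (corner e).card ≤
      4 * (normFiber σ 1).card ^ 2 := by
  classical
  have h1 := card_stab_mul_le (σ := σ) he hσe
  have h2 := card_symm_sq_le (σ := σ) hθ (e := e)
  have h3 := card_units_le hσ he hσe
  have h4 := card_corner_le_two_mul_units hsum he
  set S := ((corner e).filter fun s => σ s = s).card
  set V := ((corner e).filter fun v => v * σ v = e).card
  set E := (corner e).card
  set N := (normFiber σ 1).card
  set A := ((normFiber σ 1).filter fun u => u * e = e).card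
  have h5 : E ≤ 2 * (S * V) := h4.trans (Nat.mul_le_mul_left _ (by convert h3))
  have hE : 0 < E := Finset.card_pos.2 ⟨0, by simp [mem_corner]⟩
  have h6 : E * E ≤ (4 * V ^ 2) * E := by
    calc E * E ≤ (2 * (S * V)) * (2 * (S * V)) := Nat.mul_le_mul h5 h5
      _ = (4 * V ^ 2) * S ^ 2 := by ring
      _ ≤ (4 * V ^ 2) * E := Nat.mul_le_mul_left _ h2
  have h7 := Nat.le_of_mul_le_mul_right h6 hE
  calc A ^ 2 * E ≤ A ^ 2 * (4 * V ^ 2) := Nat.mul_le_mul_left _ h7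
    _ = 4 * (A * V) ^ 2 := by ring
    _ ≤ 4 * N ^ 2 := Nat.mul_le_mul_left _ (Nat.pow_le_pow_left h1 2)

theorem card_normFiber_one_le {g₀ : R} (hg₀ : g₀ ∈ normFiber σ (-1)) :
    (normFiber σ 1).card ≤ (normFiber σ (-1)).card := by
  rw [mem_normFiber] at hg₀
  refine Finset.card_le_card_of_injOn (fun u => g₀ * u) ?_ ?_
  · intro u hu
    rw [Finset.mem_coe, mem_normFiber] at hu
    rw [Finset.mem_coe, mem_normFiber, map_mul]
    linear_combination u * σ u * hg₀ - hu
  · intro u _ u' _ heq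
    simp only at heq
    linear_combination -σ g₀ * heq + (u - u') * hg₀

/-- For two solutions g and g₁, the quotient g/g₁ = -gσ(g₁) has norm one and fixes a. Having norm
one it also fixes σ(a), hence e, which is built from a and σ(a). -/
theorem card_filter_mul_eq_le {e a c : R} (hec : e = a * c + σ (a * c) - a * c * σ (a * c))
    (b : R) : ((normFiber σ (-1)).filter fun g => a * g = b).card ≤
      ((normFiber σ 1).filter fun u => u * e = e).card := by
  rcases ((normFiber σ (-1)).filter fun g => a * g = b).eq_empty_or_nonempty with h | ⟨g₁, h₁⟩
  · simp [h]
  rw [Finset.mem_filter, mem_normFiber] at h₁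
  obtain ⟨h₁, hb₁⟩ := h₁
  have hσ₁ := congrArg σ h₁
  rw [map_mul, map_neg, map_one] at hσ₁
  refine Finset.card_le_card_of_injOn (fun g => -(g * σ g₁)) ?_ ?_
  · intro g hg
    simp only [Finset.mem_coe, Finset.mem_filter, mem_normFiber] at hg ⊢
    obtain ⟨hg, hb⟩ := hg
    have hu : -(g * σ g₁) * σ (-(g * σ g₁)) = 1 := by
      rw [map_neg, map_mul]
      linear_combination σ g₁ * σ (σ g₁) * hg - hσ₁
    have ha : -(g * σ g₁) * a = a := by
      linear_combination -σ g₁ * hb + σ g₁ * hb₁ - a * h₁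
    refine ⟨hu, ?_⟩
    set u := -(g * σ g₁)
    have hσa : u * σ a = σ a := by
      have := congrArg σ ha
      rw [map_mul] at this
      linear_combination σ a * hu - u * this
    rw [hec, map_mul]
    linear_combination c * ha + σ c * hσa - c * σ a * σ c * ha
  · intro g _ g' _ heq
    simp only at heq
    linear_combination g₁ * heq + (g - g') * h₁

open scoped Classical in
-- By the Chinese remainder theorem eR is the product of the residue fields at which e is nonzero.
theorem prod_card_quotient_le [IsReduced R] [∀ m : Ideal R, Fintype (R ⧸ m)]
    [Fintype (MaximalSpectrum R)] {e : R} (he : e * e = e) :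
    ∏ m ∈ Finset.univ.filter (fun m : MaximalSpectrum R => e ∉ m.asIdeal),
      Fintype.card (R ⧸ m.asIdeal) ≤ (corner e).card := by
  set φ := IsArtinianRing.equivPi R
  set t : ∀ m : MaximalSpectrum R, Finset (R ⧸ m.asIdeal) :=
    fun m => if e ∈ m.asIdeal then {0} else Finset.univ
  have hcard : (Fintype.piFinset t).card =
      ∏ m ∈ Finset.univ.filter (fun m : MaximalSpectrum R => e ∉ m.asIdeal),
        Fintype.card (R ⧸ m.asIdeal) := by
    rw [Fintype.card_piFinset, Finset.prod_filter]
    refine Finset.prod_congr rfl fun m _ => ?_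
    by_cases h : e ∈ m.asIdeal <;> simp [t, h]
  rw [← hcard]
  refine Finset.card_le_card_of_injOn (fun y => e * φ.symm y) ?_ ?_
  · intro y _
    rw [Finset.mem_coe, mem_corner, ← mul_assoc, he]
  · intro y hy y' hy' heq
    have key : ∀ z ∈ Fintype.piFinset t, φ (e * φ.symm z) = z := by
      intro z hz
      funext m
      have hzm := Fintype.mem_piFinset.1 hz m
      have hem : φ e m = Ideal.Quotient.mk _ e := rfl
      rw [map_mul, Pi.mul_apply, AlgEquiv.apply_symm_apply, hem]
      by_cases h : e ∈ m.asIdeal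
      · rw [Ideal.Quotient.eq_zero_iff_mem.2 h, zero_mul]
        simp only [t, h, if_true, Finset.mem_singleton] at hzm
        exact hzm.symm
      · have := m.isMaximal.isPrime
        have h1 : Ideal.Quotient.mk m.asIdeal e = 1 := by
          rw [← map_one (Ideal.Quotient.mk m.asIdeal), eq_comm, Ideal.Quotient.eq]
          exact one_sub_mem_of_notMem he h
        rw [h1, one_mul]
    exact (key y hy).symm.trans ((congrArg φ heq).trans (key y' hy'))

end Involution

/-! ### Entropy bound for light words in translation-invariant codes. -/

/-- The point z = δ/((1-δ)(q-1)) minimises z^(-δ)(1+(q-1)z) over z > 0, so it is the optimal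
parameter in the Chernoff bound below. -/
theorem rpow_qEntropy {q : ℕ} (hq : 2 ≤ q) {δ : ℝ} (h0 : 0 < δ) (h1 : δ < 1) :
    (δ / ((1 - δ) * (q - 1))) ^ (-δ) * (1 + (q - 1) * (δ / ((1 - δ) * (q - 1)))) =
      (q : ℝ) ^ qEntropy q δ := by
  have hq' : (2 : ℝ) ≤ q := by exact_mod_cast hq
  have hq1 : (0 : ℝ) < q - 1 := by linarith
  have hd : 0 < 1 - δ := by linarith
  have hlq : Real.log q ≠ 0 := (Real.log_pos (by linarith)).ne'
  have e1 : 1 + (q - 1) * (δ / ((1 - δ) * (q - 1))) = (1 - δ)⁻¹ := by field_simp; ring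
  rw [e1]
  refine Real.log_injOn_pos (Set.mem_Ioi.2 (by positivity)) (Set.mem_Ioi.2 (by positivity)) ?_
  rw [Real.log_mul (by positivity) (by positivity), Real.log_rpow (by positivity),
    Real.log_rpow (by positivity), Real.log_inv, Real.log_div h0.ne' (by positivity),
    Real.log_mul hd.ne' hq1.ne', qEntropy]
  simp only [Real.logb]
  field_simp
  ring

/-- Take a maximal linearly independent family among the coordinate functionals restricted to V: it
has at most dim V members and spans all the others. -/
theorem exists_information_set {F ι : Type*} [Field F] [Finite ι] (V : Submodule F (ι → F)) :
    ∃ I : Finset ι, I.card ≤ Module.finrank F V ∧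
      ∀ v ∈ V, (∀ i ∈ I, v i = 0) → v = 0 := by
  classical
  obtain ⟨κ, a, ha, hspan, hli⟩ := exists_linearIndependent' F
    (fun i : ι => (LinearMap.proj i : (ι → F) →ₗ[F] F) ∘ₗ V.subtype)
  have : Finite κ := Finite.of_injective a ha
  have := Fintype.ofFinite κ
  refine ⟨Finset.univ.image a, ?_, ?_⟩
  · rw [Finset.card_image_of_injective _ ha, Finset.card_univ, ← Subspace.dual_finrank_eq]
    exact hli.fintype_card_le_finrank
  · intro v hv hI
    funext i
    have hmem : (LinearMap.proj i : (ι → F) →ₗ[F] F) ∘ₗ V.subtype ∈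
        Submodule.span F (Set.range fun i : ι =>
          (LinearMap.proj i : (ι → F) →ₗ[F] F) ∘ₗ V.subtype) :=
      Submodule.subset_span ⟨i, rfl⟩
    rw [← hspan] at hmem
    have hker : Submodule.span F (Set.range ((fun i : ι =>
          (LinearMap.proj i : (ι → F) →ₗ[F] F) ∘ₗ V.subtype) ∘ a)) ≤
        LinearMap.ker (LinearMap.applyₗ (⟨v, hv⟩ : V)) := by
      rw [Submodule.span_le]
      rintro _ ⟨k, rfl⟩
      simpa using hI (a k) (Finset.mem_image_of_mem _ (Finset.mem_univ k))
    simpa using hker hmem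

theorem sum_card_filter_translate {F G : Type*} [Field F] [DecidableEq F] [AddCommGroup G]
    [Fintype G] (I : Finset G) (v : G → F) :
    ∑ j : G, (I.filter fun i => v (i + j) ≠ 0).card = I.card * hammingNorm v := by
  simp_rw [Finset.card_filter]
  rw [Finset.sum_comm, ← smul_eq_mul, ← Finset.sum_const]
  refine Finset.sum_congr rfl fun i _ => ?_
  rw [hammingNorm, Finset.card_filter]
  exact Equiv.sum_comp (Equiv.addLeft i) fun j => if v j ≠ 0 then 1 else 0

section Balanced

variable {F : Type*} [Field F] [Fintype F] [DecidableEq F]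

theorem sum_pow_hammingNorm {κ : Type*} [Fintype κ] [DecidableEq κ] (z : ℝ) :
    ∑ y : κ → F, z ^ hammingNorm y = (1 + (Fintype.card F - 1) * z) ^ Fintype.card κ := by
  have h1 : ∀ y : κ → F, z ^ hammingNorm y = ∏ i, if y i = 0 then 1 else z := by
    intro y
    rw [hammingNorm, Finset.prod_ite, Finset.prod_const_one, one_mul, Finset.prod_const]
  have h2 : ∑ c : F, (if c = 0 then 1 else z) = 1 + (Fintype.card F - 1) * z := by
    rw [Finset.sum_ite, Finset.sum_const, Finset.sum_const]
    have h3 : (Finset.univ.filter fun c : F => c = 0).card = 1 := by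
      rw [Finset.filter_eq' Finset.univ (0 : F)]; simp
    have h4 := Finset.card_filter_add_card_filter_not (s := (Finset.univ : Finset F))
      (fun c => c = 0)
    rw [h3, Finset.card_univ] at h4
    rw [h3, ← h4]
    push_cast
    simp
  simp_rw [h1]
  rw [← h2, ← Finset.card_univ, ← Finset.prod_const, Finset.prod_univ_sum, Fintype.piFinset_univ]

variable {G : Type*} [AddCommGroup G] [Fintype G] [DecidableEq G]

open scoped Classical in
-- The translates of an information set I cover G evenly. By averaging, a light pair is therefore
-- also light on some translate I + j, and restriction to I + j is injective on V. A Chernoff bound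
-- in F^I × F^I for each j, summed over j, gives the factor |G|.
theorem card_light_pairs_le (V : Submodule F (G → F))
    (hV : ∀ v ∈ V, ∀ j : G, (fun i => v (i + j)) ∈ V) {δ : ℝ} (h0 : 0 < δ)
    (h1 : δ < 1 - (Fintype.card F : ℝ)⁻¹) :
    ((Finset.univ.filter fun x : (G → F) × (G → F) => x.1 ∈ V ∧ x.2 ∈ V ∧
      ((hammingNorm x.1 + hammingNorm x.2 : ℕ) : ℝ) ≤ δ * (2 * Fintype.card G)).card : ℝ) ≤
      Fintype.card G * ((Fintype.card F : ℝ) ^ Module.finrank F V) ^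
        (2 * qEntropy (Fintype.card F) δ) := by
  set q := Fintype.card F
  have hq : 2 ≤ q := Fintype.one_lt_card
  have hq' : (2 : ℝ) ≤ q := by exact_mod_cast hq
  have hqi : (0 : ℝ) < (q : ℝ)⁻¹ := by positivity
  have hq1 : (0 : ℝ) < q - 1 := by linarith
  have hd : 0 < 1 - δ := by linarith
  obtain ⟨I, hIcard, hI⟩ := exists_information_set V
  set z : ℝ := δ / ((1 - δ) * (q - 1)) with hz
  have hz0 : 0 < z := by positivity
  -- This is where δ < 1 - 1/q enters: z ≤ 1 makes z^(weight - threshold) at least 1 on light words.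
  have hz1 : z ≤ 1 := by
    rw [hz, div_le_one (by positivity)]
    have : δ * q < (1 - (q : ℝ)⁻¹) * q := mul_lt_mul_of_pos_right h1 (by linarith)
    rw [sub_mul, inv_mul_cancel₀ (by linarith)] at this
    linarith
  set wt : G → (G → F) → ℕ := fun j v => (I.filter fun i => v (i + j) ≠ 0).card
  have hsum : ∀ j : G, ∑ v ∈ Finset.univ.filter (· ∈ V), z ^ wt j v ≤
      (1 + (q - 1) * z) ^ I.card := by
    intro j
    have := sum_pow_hammingNorm (F := F) (κ := I) z
    rw [Fintype.card_coe] at this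
    rw [← this]
    -- Translation invariance of V makes every translate of I an information set.
    have hinj : Set.InjOn (fun (v : G → F) (i : I) => v (i + j))
        (Finset.univ.filter (· ∈ V) : Finset (G → F)) := by
      intro v hv v' hv' heq
      simp only [Finset.coe_filter, Finset.mem_univ, true_and, Set.mem_ofPred_eq] at hv hv'
      have h3 : (fun i => (v - v') (i + j)) = 0 := by
        refine hI _ (hV _ (V.sub_mem hv hv') j) fun i hi => ?_
        have := congrFun heq ⟨i, hi⟩
        simp only at this
        simp [this]
      funext g
      have := congrFun h3 (g - j)
      simpa [sub_eq_zero] using this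
    have hwt : ∀ v, wt j v = hammingNorm (fun i : I => v (i + j)) := by
      intro v
      simp only [wt, hammingNorm]
      rw [← Finset.card_map (Function.Embedding.subtype _)]
      congr 1
      ext g
      simp [and_comm]
    simp_rw [hwt]
    rw [← Finset.sum_image (f := fun y : I → F => z ^ hammingNorm y) hinj]
    exact Finset.sum_le_sum_of_subset_of_nonneg (Finset.subset_univ _)
      fun _ _ _ => by positivity
  have hone : ∀ x : (G → F) × (G → F),
      ((hammingNorm x.1 + hammingNorm x.2 : ℕ) : ℝ) ≤ δ * (2 * Fintype.card G) →
      1 ≤ ∑ j : G, z ^ (-(δ * (2 * I.card))) * (z ^ wt j x.1 * z ^ wt j x.2) := by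
    intro x hx
    obtain ⟨j, hj⟩ : ∃ j : G, ((wt j x.1 + wt j x.2 : ℕ) : ℝ) ≤ δ * (2 * I.card) := by
      by_contra! hcon
      have h2 := Finset.sum_lt_sum_of_nonempty (s := (Finset.univ : Finset G)) ⟨0, by simp⟩
        fun j _ => hcon j
      rw [← Nat.cast_sum, Finset.sum_add_distrib, sum_card_filter_translate,
        sum_card_filter_translate, Finset.sum_const, Finset.card_univ, nsmul_eq_mul, ← mul_add]
        at h2
      have h3 := mul_le_mul_of_nonneg_left hx (Nat.cast_nonneg (α := ℝ) I.card)
      push_cast at h2 h3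
      linarith
    refine le_trans ?_ (Finset.single_le_sum (f := fun j => z ^ (-(δ * (2 * I.card))) *
      (z ^ wt j x.1 * z ^ wt j x.2)) (fun _ _ => by positivity) (Finset.mem_univ j))
    rw [← pow_add, ← Real.rpow_natCast, ← Real.rpow_add hz0]
    exact Real.one_le_rpow_of_pos_of_le_one_of_nonpos hz0 hz1 (by linarith)
  have hent' := rpow_qEntropy hq h0 (show δ < 1 by linarith)
  calc _ = ∑ x ∈ Finset.univ.filter fun x : (G → F) × (G → F) => x.1 ∈ V ∧ x.2 ∈ V ∧
      ((hammingNorm x.1 + hammingNorm x.2 : ℕ) : ℝ) ≤ δ * (2 * Fintype.card G), (1 : ℝ) := by simp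
    _ ≤ ∑ x ∈ Finset.univ.filter fun x : (G → F) × (G → F) => x.1 ∈ V ∧ x.2 ∈ V ∧
      ((hammingNorm x.1 + hammingNorm x.2 : ℕ) : ℝ) ≤ δ * (2 * Fintype.card G),
        ∑ j : G, z ^ (-(δ * (2 * I.card))) * (z ^ wt j x.1 * z ^ wt j x.2) :=
      Finset.sum_le_sum fun x hx => hone x (Finset.mem_filter.1 hx).2.2.2
    _ ≤ ∑ x ∈ Finset.univ.filter (· ∈ V) ×ˢ Finset.univ.filter (· ∈ V),
        ∑ j : G, z ^ (-(δ * (2 * I.card))) * (z ^ wt j x.1 * z ^ wt j x.2) := by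
      refine Finset.sum_le_sum_of_subset_of_nonneg ?_ fun _ _ _ =>
        Finset.sum_nonneg fun _ _ => by positivity
      intro x hx
      simp only [Finset.mem_filter, Finset.mem_univ, true_and, Finset.mem_product] at hx ⊢
      exact ⟨hx.1, hx.2.1⟩
    _ = ∑ j : G, z ^ (-(δ * (2 * I.card))) * ((∑ v ∈ Finset.univ.filter (· ∈ V), z ^ wt j v) *
          ∑ v ∈ Finset.univ.filter (· ∈ V), z ^ wt j v) := by
      rw [Finset.sum_comm]
      refine Finset.sum_congr rfl fun j _ => ?_
      rw [← Finset.mul_sum, Finset.sum_mul_sum, Finset.sum_product]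
    _ ≤ ∑ j : G, z ^ (-(δ * (2 * I.card))) *
          ((1 + (q - 1) * z) ^ I.card * (1 + (q - 1) * z) ^ I.card) := by
      gcongr with j _
      · exact hsum j
      · exact hsum j
    _ = Fintype.card G * ((q : ℝ) ^ I.card) ^ (2 * qEntropy q δ) := by
      rw [Finset.sum_const, Finset.card_univ, nsmul_eq_mul]
      congr 1
      have hp : (0 : ℝ) < 1 + (q - 1) * z := by positivity
      have e1 : z ^ (-(δ * (2 * I.card))) = (z ^ (-δ)) ^ (2 * I.card) := by
        rw [← Real.rpow_mul_natCast hz0.le]; push_cast; ring_nf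
      rw [e1, ← pow_add, ← two_mul, ← mul_pow, hent', ← Real.rpow_mul_natCast (by positivity),
        ← Real.rpow_natCast (q : ℝ), ← Real.rpow_mul (by positivity)]
      push_cast; ring_nf
    _ ≤ _ := by
      have hp : (0 : ℝ) ≤ (q - 1) * z := by positivity
      have h2 : (1 : ℝ) ≤ (q : ℝ) ^ qEntropy q δ := by
        rw [← hent']
        exact one_le_mul_of_one_le_of_one_le
          (Real.one_le_rpow_of_pos_of_le_one_of_nonpos hz0 hz1 (by linarith)) (by linarith)
      have hent : 0 ≤ qEntropy q δ := by
        by_contra! hneg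
        exact absurd h2 (not_le.2 (Real.rpow_lt_one_of_one_lt_of_neg (by linarith) hneg))
      gcongr
      linarith

end Balanced

/-! ### The algebra F[X]/(X^n-1) and its codes. -/

section CyclicCodes

variable {F : Type*} [Field F] {n : ℕ}

theorem CycAlg.x_pow_mod (k : ℕ) : CycAlg.x F n ^ (k % n) = CycAlg.x F n ^ k :=
  (pow_eq_pow_mod k (CycAlg.x_pow n)).symm

theorem CycAlg.x_pow_val_add (i j : Fin n) :
    CycAlg.x F n ^ ((i + j : Fin n) : ℕ) = CycAlg.x F n ^ (i : ℕ) * CycAlg.x F n ^ (j : ℕ) := by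
  rw [Fin.val_add, CycAlg.x_pow_mod, pow_add]

theorem cycStar_of (p h : ℕ) [Fact p.Prime] [CharP F p] (c : F) :
    cycStar p h n (AdjoinRoot.of _ c) = AdjoinRoot.of _ (c ^ p ^ h) := by
  rw [cycStar, AdjoinRoot.lift_of, RingHom.comp_apply, iterateFrobenius_def]

theorem cycAlg_isReduced (hn : (n : F) ≠ 0) : IsReduced (CycAlg F n) := by
  have hsq : Squarefree (X ^ n - 1 : F[X]) := (X_pow_sub_one_separable_iff.2 hn).squarefree
  refine (Ideal.isRadical_iff_quotient_reduced _).1 ?_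
  exact isRadical_iff_span_singleton.1 hsq.isRadical

theorem mem_pairCode_one {g : CycAlg F n} {c : Fin n ⊕ Fin n → F} :
    c ∈ pairCode 1 g ↔
      wordToCyc F n (c ∘ Sum.inr) = wordToCyc F n (c ∘ Sum.inl) * g := by
  have : wordToCycPair F n c = (wordToCyc F n (c ∘ Sum.inl), wordToCyc F n (c ∘ Sum.inr)) := rfl
  rw [pairCode, Submodule.mem_comap, Submodule.restrictScalars_mem,
    Submodule.mem_span_singleton, this]
  constructor
  · rintro ⟨r, hr⟩
    simp only [Prod.smul_mk, smul_eq_mul, mul_one, Prod.mk.injEq] at hr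
    rw [← hr.1, ← hr.2]
  · intro h
    exact ⟨_, by rw [Prod.smul_mk, smul_eq_mul, smul_eq_mul, mul_one, ← h]⟩

/-- In the residue field, of size q^d, the image of x is not 1 and so has order exactly the prime n.
Hence n divides q^d - 1, and the order of q modulo n divides d. -/
theorem pow_orderOf_le_card_quotient [Fintype F] (hn : n.Prime) {m : Ideal (CycAlg F n)}
    (hm : m.IsMaximal) (h : CycAlg.x F n - 1 ∉ m) [Fintype (CycAlg F n ⧸ m)] :
    Fintype.card F ^ orderOf (Fintype.card F : ZMod n) ≤ Fintype.card (CycAlg F n ⧸ m) := by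
  let := Ideal.Quotient.field m
  set y := Ideal.Quotient.mk m (CycAlg.x F n)
  have hy : y ^ n = 1 := by rw [← map_pow, CycAlg.x_pow, map_one]
  have hy1 : y ≠ 1 := by
    intro h1
    rw [← map_one (Ideal.Quotient.mk m), Ideal.Quotient.eq] at h1
    exact h h1
  have := Fact.mk hn
  have hord : orderOf y = n := orderOf_eq_prime hy hy1
  have hy0 : y ≠ 0 := by rintro h0; rw [h0, zero_pow hn.ne_zero] at hy; exact zero_ne_one hy
  have hcard : Fintype.card (CycAlg F n ⧸ m) = Fintype.card F ^ Module.finrank F (CycAlg F n ⧸ m) :=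
    Module.card_eq_pow_finrank
  have hdvd : n ∣ Fintype.card F ^ Module.finrank F (CycAlg F n ⧸ m) - 1 := by
    rw [← hcard]
    refine hord.symm.dvd.trans ?_
    exact orderOf_dvd_of_pow_eq_one (FiniteField.pow_card_sub_one_eq_one y hy0)
  have hone : (Fintype.card F : ZMod n) ^ Module.finrank F (CycAlg F n ⧸ m) = 1 := by
    rw [← ZMod.natCast_eq_zero_iff, Nat.cast_sub (Nat.one_le_pow _ _ Fintype.card_pos)] at hdvd
    push_cast at hdvd
    exact sub_eq_zero.1 hdvd
  have hfin : 0 < Module.finrank F (CycAlg F n ⧸ m) := by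
    refine Nat.pos_of_ne_zero fun h0 => ?_
    rw [h0, pow_zero] at hcard
    exact absurd hcard Fintype.one_lt_card.ne'
  rw [hcard]
  exact Nat.pow_le_pow_right Fintype.card_pos
    (Nat.le_of_dvd hfin (orderOf_dvd_of_pow_eq_one hone))

variable [NeZero n]

variable (F n) in
/-- The monomial basis of `F[X] / (X^n - 1)`. -/
noncomputable def cycBasis : Module.Basis (Fin n) F (CycAlg F n) :=
  (AdjoinRoot.powerBasis' (g := (X ^ n - 1 : F[X]))
    (by simpa using monic_X_pow_sub_C (1 : F) (NeZero.ne n))).basis.reindex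
    (finCongr (by rw [AdjoinRoot.powerBasis'_dim, ← C_1, natDegree_X_pow_sub_C]))

theorem cycBasis_apply (i : Fin n) : cycBasis F n i = CycAlg.x F n ^ (i : ℕ) := by
  rw [cycBasis, Module.Basis.reindex_apply, PowerBasis.basis_eq_pow, AdjoinRoot.powerBasis'_gen]
  simp

theorem wordToCyc_eq (a : Fin n → F) : wordToCyc F n a = (cycBasis F n).equivFun.symm a := by
  rw [wordToCyc, Fintype.linearCombination_apply, Module.Basis.equivFun_symm_apply]
  simp only [cycBasis_apply]

theorem wordToCyc_bijective : Function.Bijective (wordToCyc F n) := by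
  have : (wordToCyc F n : (Fin n → F) → CycAlg F n) = (cycBasis F n).equivFun.symm :=
    funext wordToCyc_eq
  rw [this]
  exact (cycBasis F n).equivFun.symm.bijective

theorem wordToCyc_translate (a : Fin n → F) (j : Fin n) :
    wordToCyc F n (fun i => a (i - j)) = CycAlg.x F n ^ (j : ℕ) * wordToCyc F n a := by
  simp only [wordToCyc, Fintype.linearCombination_apply, Finset.mul_sum]
  rw [← Equiv.sum_comp (Equiv.addRight j)]
  refine Finset.sum_congr rfl fun i _ => ?_
  rw [Equiv.coe_addRight, add_sub_cancel_right, CycAlg.x_pow_val_add, mul_smul_comm, mul_comm]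

theorem wordToCyc_finRotate (a : Fin n → F) :
    wordToCyc F n (fun i => a ((finRotate n).symm i)) = CycAlg.x F n * wordToCyc F n a := by
  obtain ⟨m, rfl⟩ := Nat.exists_eq_succ_of_ne_zero (NeZero.ne n)
  have h : ∀ i : Fin (m + 1), (finRotate (m + 1)).symm i = i - 1 := fun i => by
    rw [Equiv.symm_apply_eq, finRotate_apply, sub_add_cancel]
  have h1 : CycAlg.x F (m + 1) ^ ((1 : Fin (m + 1)) : ℕ) = CycAlg.x F (m + 1) := by
    rw [Fin.val_one', CycAlg.x_pow_mod, pow_one]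
  simp only [Nat.succ_eq_add_one, h, wordToCyc_translate, h1]

/-- The constant coefficient of an element of `F[X] / (X^n - 1)`. -/
noncomputable def constCoeff (r : CycAlg F n) : F := (cycBasis F n).equivFun r 0

theorem constCoeff_wordToCyc (a : Fin n → F) : constCoeff (wordToCyc F n a) = a 0 := by
  rw [constCoeff, wordToCyc_eq, LinearEquiv.apply_symm_apply]

theorem constCoeff_x_pow (i : Fin n) :
    constCoeff (CycAlg.x F n ^ (i : ℕ)) = if i = 0 then 1 else 0 := by
  rw [constCoeff, ← cycBasis_apply, Module.Basis.equivFun_self]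

theorem eq_zero_of_constCoeff_mul_eq_zero {r : CycAlg F n}
    (h : ∀ s, constCoeff (s * r) = 0) : r = 0 := by
  obtain ⟨a, rfl⟩ := wordToCyc_bijective.2 r
  have : a = 0 := by
    funext j
    have hj := h (CycAlg.x F n ^ ((-j : Fin n) : ℕ))
    rwa [← wordToCyc_translate, constCoeff_wordToCyc, sub_neg_eq_add, zero_add] at hj
  rw [this, map_zero]

/-- The star inverts x, so the monomials x^i and (x^j)* contribute to the constant term only when i
= j. Orthogonality thus becomes a ring identity. -/
theorem constCoeff_mul_cycStar (p h : ℕ) [Fact p.Prime] [CharP F p] (c a : Fin n → F) :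
    constCoeff (wordToCyc F n c * cycStar p h n (wordToCyc F n a)) = galoisInner p h c a := by
  have hx : ∀ i j : Fin n, CycAlg.x F n ^ (i : ℕ) * CycAlg.x F n ^ ((n - 1) * (j : ℕ)) =
      CycAlg.x F n ^ ((i - j : Fin n) : ℕ) := by
    intro i j
    conv_lhs => rw [← sub_add_cancel i j]
    rw [CycAlg.x_pow_val_add, mul_assoc, ← pow_add,
      show (j : ℕ) + (n - 1) * j = n * j by
        rw [← one_add_mul, Nat.add_sub_cancel' (Nat.one_le_iff_ne_zero.2 (NeZero.ne n))],
      pow_mul, CycAlg.x_pow, one_pow, mul_one]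
  have hlin : constCoeff = ((LinearMap.proj 0 : (Fin n → F) →ₗ[F] F) ∘ₗ
    (cycBasis F n).equivFun.toLinearMap : CycAlg F n →ₗ[F] F) := rfl
  have hc : ∀ i j : Fin n, constCoeff (CycAlg.x F n ^ (i : ℕ) * CycAlg.x F n ^ ((n - 1) * (j : ℕ))) =
      if i = j then 1 else 0 := by
    intro i j
    rw [hx, constCoeff_x_pow]
    simp only [sub_eq_zero]
  rw [cycStar_wordToCyc, wordToCyc, Fintype.linearCombination_apply, Finset.sum_mul_sum]
  simp only [smul_mul_smul_comm]
  rw [hlin]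
  simp only [map_sum, map_smul]
  rw [← hlin]
  simp [hc, galoisInner]

theorem cycStar_x_mul (p h : ℕ) [Fact p.Prime] [CharP F p] :
    cycStar p h n (CycAlg.x F n) * CycAlg.x F n = 1 := by
  rw [cycStar, AdjoinRoot.lift_root, ← pow_succ, Nat.sub_add_cancel (NeZero.pos n), CycAlg.x_pow]

theorem cycStar_cycStar [Fintype F] (p h : ℕ) [Fact p.Prime] [CharP F p]
    (hF : Fintype.card F = p ^ h * p ^ h) (r : CycAlg F n) :
    cycStar p h n (cycStar p h n r) = r := by
  have h1 : (cycStar p h n).comp (cycStar p h n) = RingHom.id (CycAlg F n) := by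
    apply AdjoinRoot.ringHom_ext
    · ext c
      simp only [RingHom.comp_apply, RingHom.id_apply, cycStar_of]
      rw [← pow_mul, ← hF, FiniteField.pow_card]
    · have h2 := cycStar_x_mul (F := F) (n := n) p h
      have h3 := congrArg (cycStar p h n) h2
      rw [map_mul, map_one] at h3
      simp only [RingHom.comp_apply, RingHom.id_apply]
      linear_combination CycAlg.x F n * h3 - cycStar p h n (cycStar p h n (CycAlg.x F n)) * h2
  exact RingHom.congr_fun h1 r

theorem isTwoQuasiCyclic_pairCode (g : CycAlg F n) : IsTwoQuasiCyclic (pairCode 1 g) := by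
  intro c hc
  rw [mem_pairCode_one] at hc ⊢
  have h1 := wordToCyc_finRotate (c ∘ Sum.inl)
  have h2 := wordToCyc_finRotate (c ∘ Sum.inr)
  have e1 : doubleShift c ∘ Sum.inl = fun i => (c ∘ Sum.inl) ((finRotate n).symm i) := rfl
  have e2 : doubleShift c ∘ Sum.inr = fun i => (c ∘ Sum.inr) ((finRotate n).symm i) := rfl
  rw [e1, e2, h1, h2, hc, mul_assoc]

theorem isGaloisSelfDual_pairCode (p h : ℕ) [Fact p.Prime] [CharP F p] [Fintype F]
    (hF : Fintype.card F = p ^ h * p ^ h) {g : CycAlg F n} (hg : g * cycStar p h n g = -1) :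
    IsGaloisSelfDual p h (pairCode 1 g) := by
  have hsplit : ∀ c a : Fin n ⊕ Fin n → F, galoisInner p h c a =
      constCoeff (wordToCyc F n (c ∘ Sum.inl) * cycStar p h n (wordToCyc F n (a ∘ Sum.inl))) +
      constCoeff (wordToCyc F n (c ∘ Sum.inr) * cycStar p h n (wordToCyc F n (a ∘ Sum.inr))) := by
    intro c a
    rw [constCoeff_mul_cycStar, constCoeff_mul_cycStar]
    simp [galoisInner]
  have hadd : ∀ r s : CycAlg F n, constCoeff (r + s) = constCoeff r + constCoeff s := by
    intro r s; simp [constCoeff]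
  have hzero : constCoeff (0 : CycAlg F n) = 0 := by simp [constCoeff]
  ext a
  simp only [SetLike.mem_coe, galoisDual, Set.mem_ofPred_eq]
  constructor
  · intro ha c hc
    rw [mem_pairCode_one] at ha hc
    rw [hsplit, ← hadd, ha, hc, map_mul]
    rw [← hzero]
    congr 1
    linear_combination wordToCyc F n (c ∘ Sum.inl) *
      cycStar p h n (wordToCyc F n (a ∘ Sum.inl)) * hg
  · intro ha
    -- Write (r, t) for the pair given by a. Testing against all codewords (s, sg) yields r* + g t*
    -- = 0. Applying the star and multiplying by g turns this into t = rg.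
    have h0 : cycStar p h n (wordToCyc F n (a ∘ Sum.inl)) +
        g * cycStar p h n (wordToCyc F n (a ∘ Sum.inr)) = 0 := by
      refine eq_zero_of_constCoeff_mul_eq_zero fun s => ?_
      obtain ⟨u, hu⟩ := wordToCyc_bijective.2 s
      obtain ⟨v, hv⟩ := wordToCyc_bijective.2 (s * g)
      have h1 := ha (Sum.elim u v) (by
        rw [mem_pairCode_one, Sum.elim_comp_inl, Sum.elim_comp_inr, hu, hv])
      rw [hsplit, Sum.elim_comp_inl, Sum.elim_comp_inr, hu, hv, ← hadd] at h1
      rw [← h1]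
      congr 1
      ring
    have h1 := congrArg (cycStar p h n) h0
    rw [map_add, map_mul, map_zero, cycStar_cycStar p h hF, cycStar_cycStar p h hF] at h1
    rw [mem_pairCode_one]
    linear_combination -g * h1 + wordToCyc F n (a ∘ Sum.inr) * hg

theorem codeRate_pairCode (g : CycAlg F n) : codeRate (pairCode 1 g) = 1 / 2 := by
  have hfin : Module.finrank F (pairCode 1 g) = n := by
    have e : pairCode 1 g ≃ₗ[F] (Fin n → F) :=
      LinearEquiv.ofBijective (LinearMap.funLeft F F Sum.inl ∘ₗ (pairCode 1 g).subtype) (by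
        constructor
        · rw [← LinearMap.ker_eq_bot, LinearMap.ker_eq_bot']
          rintro ⟨c, hc⟩ h
          have h1 : c ∘ Sum.inl = 0 := h
          rw [mem_pairCode_one, h1, map_zero, zero_mul] at hc
          have h2 : c ∘ Sum.inr = 0 := wordToCyc_bijective.1 (by rw [hc, map_zero])
          ext (i | i)
          · exact congrFun h1 i
          · exact congrFun h2 i
        · intro u
          obtain ⟨v, hv⟩ := wordToCyc_bijective.2 (wordToCyc F n u * g)
          exact ⟨⟨Sum.elim u v, by
            rw [mem_pairCode_one, Sum.elim_comp_inl, Sum.elim_comp_inr, hv]⟩, rfl⟩)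
    rw [e.finrank_eq, Module.finrank_fin_fun]
  rw [codeRate, hfin, Fintype.card_sum, Fintype.card_fin]
  have : (n : ℝ) ≠ 0 := by exact_mod_cast NeZero.ne n
  push_cast
  field_simp
  norm_num

theorem lt_relMinDistance_pairCode [DecidableEq F] {g : CycAlg F n} {δ : ℝ}
    (h : ∀ u v : Fin n → F, u ≠ 0 → wordToCyc F n v = wordToCyc F n u * g →
      δ * (2 * n) < (hammingNorm u + hammingNorm v : ℕ)) :
    δ < relMinDistance (pairCode 1 g) := by
  have hn : (0 : ℝ) < n := by exact_mod_cast NeZero.pos n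
  have hcard : (Fintype.card (Fin n ⊕ Fin n) : ℝ) = 2 * n := by
    rw [Fintype.card_sum, Fintype.card_fin]; push_cast; ring
  rw [relMinDistance, hcard, lt_div_iff₀ (by positivity), minDistance]
  -- The infimum of the empty set is 0 in ℕ, so a pair of distinct codewords is needed for the
  -- minimum to be attained.
  have hne : {d | ∃ c ∈ pairCode 1 g, ∃ c' ∈ pairCode 1 g, c ≠ c' ∧ hammingDist c c' = d}.Nonempty := by
    obtain ⟨v, hv⟩ := wordToCyc_bijective.2 (wordToCyc F n (fun _ => 1) * g)
    refine ⟨_, Sum.elim (fun _ => 1) v, ?_, 0, zero_mem _, ?_, rfl⟩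
    · rw [mem_pairCode_one, Sum.elim_comp_inl, Sum.elim_comp_inr, hv]
    · intro h0
      exact one_ne_zero (congrFun h0 (Sum.inl 0))
  obtain ⟨c, hc, c', hc', hcc, hd⟩ := Nat.sInf_mem hne
  rw [← hd, hammingDist_comm, hammingDist_eq_hammingNorm, neg_add_eq_sub]
  have hsub := (pairCode 1 g).sub_mem hc hc'
  rw [mem_pairCode_one] at hsub
  have hsum : hammingNorm (c - c') =
      hammingNorm ((c - c') ∘ Sum.inl) + hammingNorm ((c - c') ∘ Sum.inr) := by
    simp only [hammingNorm, Finset.card_filter, Fintype.sum_sum_type, Function.comp]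
  rw [hsum]
  refine h _ _ (fun h0 => hcc ?_) hsub
  rw [h0, map_zero, zero_mul] at hsub
  have h2 : (c - c') ∘ Sum.inr = 0 := wordToCyc_bijective.1 (by rw [hsub, map_zero])
  rw [← sub_eq_zero]
  ext (i | i)
  · exact congrFun h0 i
  · exact congrFun h2 i

/-- A word killed by x - 1 is invariant under all cyclic shifts, hence constant. -/
theorem hammingNorm_of_x_sub_one_mul [DecidableEq F] {u : Fin n → F} (hu : u ≠ 0)
    (h : (CycAlg.x F n - 1) * wordToCyc F n u = 0) : hammingNorm u = n := by
  have h1 : ∀ k : ℕ, CycAlg.x F n ^ k * wordToCyc F n u = wordToCyc F n u := by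
    intro k
    induction k with
    | zero => rw [pow_zero, one_mul]
    | succ k ih => rw [pow_succ', mul_assoc, ih]; linear_combination h
  have h2 : ∀ i j, u (i - j) = u i := fun i j => congrFun
    (wordToCyc_bijective.1 ((wordToCyc_translate u j).trans (h1 _))) i
  have h3 : ∀ i, u i ≠ 0 := by
    intro i hi
    refine hu (funext fun k => ?_)
    rw [← sub_sub_cancel i k, h2, hi, Pi.zero_apply]
  rw [hammingNorm, Finset.filter_true_of_mem fun i _ => h3 i, Finset.card_univ, Fintype.card_fin]

/-- Modulo x - 1 every element is congruent to the sum of its coefficients, a scalar. A scalar lying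
in a proper ideal is 0, so both maximal ideals are generated by x - 1. -/
theorem eq_of_x_sub_one_mem {m m' : Ideal (CycAlg F n)} (hm : m.IsMaximal) (hm' : m'.IsMaximal)
    (h : CycAlg.x F n - 1 ∈ m) (h' : CycAlg.x F n - 1 ∈ m') : m = m' := by
  refine hm.eq_of_le hm'.ne_top fun r hr => ?_
  have hx : ∀ k : ℕ, CycAlg.x F n ^ k - 1 ∈ Ideal.span {CycAlg.x F n - 1} := fun k =>
    Ideal.mem_span_singleton.2 (sub_one_dvd_pow_sub_one _ k)
  have hdec : ∃ c : F, r - algebraMap F _ c ∈ Ideal.span {CycAlg.x F n - 1} := by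
    obtain ⟨a, rfl⟩ := wordToCyc_bijective.2 r
    refine ⟨∑ i, a i, ?_⟩
    rw [wordToCyc, Fintype.linearCombination_apply, map_sum, ← Finset.sum_sub_distrib]
    refine Ideal.sum_mem _ fun i _ => ?_
    rw [Algebra.smul_def, ← mul_sub_one]
    exact Ideal.mul_mem_left _ _ (hx i)
  obtain ⟨c, hc⟩ := hdec
  have hle : Ideal.span {CycAlg.x F n - 1} ≤ m := by simpa [Ideal.span_le] using h
  have hle' : Ideal.span {CycAlg.x F n - 1} ≤ m' := by simpa [Ideal.span_le] using h'
  have hc0 : c = 0 := by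
    by_contra hc0
    have h1 := m.sub_mem hr (hle hc)
    rw [sub_sub_cancel] at h1
    exact hm.ne_top (Ideal.eq_top_of_isUnit_mem _ h1 ((IsUnit.mk0 c hc0).map _))
  rw [hc0, map_zero, sub_zero] at hc
  exact hle' hc

end CyclicCodes

/-! ### Auxiliary scalars and the sum over idempotents. -/

/-- This supplies a constant g with g g* = -1. For odd Q, a nonsquare a satisfies a^((Q²-1)/2) = -1,
and the exponent factors as (Q+1)·(Q-1)/2. -/
theorem exists_pow_add_one_eq_neg_one {F : Type*} [Field F] [Fintype F] {Q : ℕ}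
    (hF : Fintype.card F = Q * Q) : ∃ c : F, c ^ (Q + 1) = -1 := by
  by_cases h2 : ringChar F = 2
  · have : CharP F 2 := ringChar.of_eq h2
    exact ⟨1, by rw [one_pow, CharTwo.neg_eq]⟩
  · obtain ⟨a, ha⟩ := FiniteField.exists_nonsquare h2
    have ha0 : a ≠ 0 := by rintro rfl; exact ha (IsSquare.zero)
    have h1 : a ^ (Fintype.card F / 2) = -1 :=
      (FiniteField.pow_dichotomy h2 ha0).resolve_left
        fun h => ha ((FiniteField.isSquare_iff h2 ha0).2 h)
    have hodd : Fintype.card F % 2 = 1 := FiniteField.odd_card_of_char_ne_two h2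
    have hQ : Odd Q := by
      rw [hF] at hodd
      exact (Nat.odd_mul.1 (Nat.odd_iff.2 hodd)).1
    obtain ⟨k, rfl⟩ := hQ
    refine ⟨a ^ k, ?_⟩
    rw [← pow_mul, ← h1, hF]
    congr 1
    have : (2 * k + 1) * (2 * k + 1) = 2 * (k * (2 * k + 1 + 1)) + 1 := by ring
    omega

theorem exists_pow_ne_self {F : Type*} [Field F] [Fintype F] {Q : ℕ} (hQ : 1 < Q)
    (hF : Q < Fintype.card F) : ∃ c : F, c ^ Q ≠ c := by
  by_contra! h
  have hne : (X ^ Q - X : F[X]) ≠ 0 := FiniteField.X_pow_card_sub_X_ne_zero F hQ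
  have hsub : (Finset.univ : Finset F).val ≤ (X ^ Q - X : F[X]).roots := by
    rw [Multiset.le_iff_subset Finset.univ.nodup]
    intro c _
    rw [mem_roots hne]
    simp [h c]
  have h1 := (Multiset.card_le_card hsub).trans (card_roots' _)
  rw [FiniteField.X_pow_card_sub_X_natDegree_eq F hQ] at h1
  exact absurd h1 (not_le.2 hF)

theorem one_add_pow_sub_one_le {y : ℝ} {n : ℕ} (hy : 0 ≤ y) (hny : n * y ≤ 1) :
    (1 + y) ^ n - 1 ≤ 2 * (n * y) := by
  have h1 : (1 + y) ^ n ≤ Real.exp (n * y) := by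
    rw [Real.exp_nat_mul]
    exact pow_le_pow_left₀ (by linarith) (by linarith [Real.add_one_le_exp y]) n
  have h0 : 0 ≤ n * y := by positivity
  have h2 := Real.abs_exp_sub_one_le (x := n * y) (by rwa [abs_of_nonneg h0])
  rw [abs_of_nonneg h0] at h2
  linarith [le_abs_self (Real.exp (n * y) - 1)]

theorem eq_zero_of_forall_mem_maximal {R : Type*} [CommRing R] [IsArtinianRing R] [IsReduced R]
    {r : R} (h : ∀ m : MaximalSpectrum R, r ∈ m.asIdeal) : r = 0 := by
  apply (IsArtinianRing.equivPi R).injective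
  funext m
  rw [IsArtinianRing.equivPi_apply, map_zero]
  exact Ideal.Quotient.eq_zero_iff_mem.2 (h m)

open scoped Classical in
-- An idempotent is determined by the set of maximal ideals avoiding it. Its trace on P is a
-- nonempty subset, which gives (1+y)^|P| - 1 by the binomial theorem. Its trace on the at most one
-- ideal outside P costs a factor of at most 2.
theorem sum_pow_card_le {R : Type*} [CommRing R] [IsArtinianRing R] [IsReduced R]
    [Fintype (MaximalSpectrum R)] (E : Finset R) (hE : ∀ e ∈ E, e * e = e)
    (P : Finset (MaximalSpectrum R)) (hEP : ∀ e ∈ E, ∃ m ∈ P, e ∉ m.asIdeal) (hPc : Pᶜ.card ≤ 1)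
    {y : ℝ} (hy : 0 ≤ y) :
    ∑ e ∈ E, y ^ (P.filter fun m => e ∉ m.asIdeal).card ≤ 2 * ((1 + y) ^ P.card - 1) := by
  set T : R → Finset (MaximalSpectrum R) × Finset (MaximalSpectrum R) := fun e =>
    (P.filter fun m => e ∉ m.asIdeal, Pᶜ.filter fun m => e ∉ m.asIdeal) with hT
  have hinj : Set.InjOn T E := by
    intro e he e' he' heq
    refine eq_of_forall_mem_maximal_iff (hE e he) (hE e' he') fun m => ?_
    have h1 := Finset.ext_iff.1 (Prod.ext_iff.1 heq).1 m
    have h2 := Finset.ext_iff.1 (Prod.ext_iff.1 heq).2 m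
    simp only [hT, Finset.mem_filter, Finset.mem_compl] at h1 h2
    tauto
  calc ∑ e ∈ E, y ^ (P.filter fun m => e ∉ m.asIdeal).card
      = ∑ t ∈ E.image T, y ^ t.1.card :=
        (Finset.sum_image (f := fun t : Finset _ × Finset _ => y ^ t.1.card) hinj).symm
    _ ≤ ∑ t ∈ P.powerset.erase ∅ ×ˢ Pᶜ.powerset, y ^ t.1.card := by
        refine Finset.sum_le_sum_of_subset_of_nonneg ?_ fun _ _ _ => by positivity
        intro t ht
        obtain ⟨e, he, rfl⟩ := Finset.mem_image.1 ht
        obtain ⟨m, hm, hem⟩ := hEP e he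
        exact Finset.mem_product.2 ⟨Finset.mem_erase.2
          ⟨Finset.ne_empty_of_mem (a := m) (Finset.mem_filter.2 ⟨hm, hem⟩),
            Finset.mem_powerset.2 (Finset.filter_subset _ _)⟩,
          Finset.mem_powerset.2 (Finset.filter_subset _ _)⟩
    _ = Pᶜ.powerset.card * ∑ t ∈ P.powerset.erase ∅, y ^ t.card := by
        rw [Finset.sum_product, Finset.mul_sum]
        refine Finset.sum_congr rfl fun t _ => ?_
        simp only [Finset.sum_const, nsmul_eq_mul]
    _ = Pᶜ.powerset.card * ((1 + y) ^ P.card - 1) := by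
        have h1 := Finset.sum_pow_mul_eq_add_pow y 1 P
        simp only [one_pow, mul_one] at h1
        rw [← Finset.add_sum_erase _ _ (Finset.empty_mem_powerset P), Finset.card_empty,
          pow_zero] at h1
        rw [add_comm 1 y, ← h1, add_sub_cancel_left]
    _ ≤ 2 * ((1 + y) ^ P.card - 1) := by
        have h1 : (1 : ℝ) ≤ (1 + y) ^ P.card := one_le_pow₀ (by linarith)
        refine mul_le_mul_of_nonneg_right ?_ (by linarith)
        rw [Finset.card_powerset]
        exact_mod_cast Nat.pow_le_pow_right (by norm_num : 0 < 2) hPc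

/-! ### Existence of a good g by counting. -/

section Existence

variable {F : Type*} [Field F] {n : ℕ}

/-- The words corresponding to the ideal generated by an idempotent `e`. -/
noncomputable def cornerCode (e : CycAlg F n) : Submodule F (Fin n → F) where
  carrier := {u | e * wordToCyc F n u = wordToCyc F n u}
  add_mem' := by
    intro u v hu hv
    simp only [Set.mem_ofPred_eq] at hu hv ⊢
    rw [map_add, mul_add, hu, hv]
  zero_mem' := by simp
  smul_mem' := by
    intro c u hu
    simp only [Set.mem_ofPred_eq] at hu ⊢
    rw [map_smul, mul_smul_comm, hu]

theorem mem_cornerCode {e : CycAlg F n} {u : Fin n → F} :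
    u ∈ cornerCode e ↔ e * wordToCyc F n u = wordToCyc F n u := Iff.rfl

theorem card_le_card_quotient [Fintype F] {m : Ideal (CycAlg F n)} (hm : m.IsMaximal)
    [Fintype (CycAlg F n ⧸ m)] : Fintype.card F ≤ Fintype.card (CycAlg F n ⧸ m) := by
  have := Ideal.Quotient.nontrivial_iff.2 hm.ne_top
  exact Fintype.card_le_of_injective _ (algebraMap F (CycAlg F n ⧸ m)).injective

variable [NeZero n]

theorem translate_mem_cornerCode {e : CycAlg F n} {u : Fin n → F} (hu : u ∈ cornerCode e)
    (j : Fin n) : (fun i => u (i + j)) ∈ cornerCode e := by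
  have h : (fun i => u (i + j)) = fun i => u (i - -j) := by simp only [sub_neg_eq_add]
  rw [mem_cornerCode] at hu ⊢
  rw [h, wordToCyc_translate, mul_left_comm, hu]

variable [Fintype F]

theorem pow_finrank_cornerCode [Fintype (CycAlg F n)] [DecidableEq (CycAlg F n)] (e : CycAlg F n) :
    Fintype.card F ^ Module.finrank F (cornerCode e) = (corner e).card := by
  classical
  rw [← Module.card_eq_pow_finrank (K := F) (V := cornerCode e), ← Fintype.card_coe]
  refine Fintype.card_of_bijective (f := fun u : cornerCode e =>
    (⟨wordToCyc F n u, mem_corner.2 u.2⟩ : corner e)) ⟨?_, ?_⟩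
  · intro u v h
    exact Subtype.ext (wordToCyc_bijective.1 (Subtype.ext_iff.1 h))
  · rintro ⟨w, hw⟩
    obtain ⟨u, rfl⟩ := wordToCyc_bijective.2 w
    exact ⟨⟨u, mem_corner.1 hw⟩, rfl⟩

/-- The ring has q^n elements and each residue field contributes a factor of at least q. -/
theorem card_finset_maximal_le [Finite (CycAlg F n)] [IsReduced (CycAlg F n)]
    (P : Finset (MaximalSpectrum (CycAlg F n))) : P.card ≤ n := by
  classical
  have := Fintype.ofFinite (CycAlg F n)
  have : ∀ m : Ideal (CycAlg F n), Fintype (CycAlg F n ⧸ m) := fun m => Fintype.ofFinite _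
  have := Fintype.ofFinite (MaximalSpectrum (CycAlg F n))
  have h1 := prod_card_quotient_le (R := CycAlg F n) (e := 1) (one_mul 1)
  have h2 : (corner (1 : CycAlg F n)).card = Fintype.card F ^ n := by
    rw [corner, Finset.filter_true_of_mem fun w _ => one_mul w, Finset.card_univ,
      ← Fintype.card_of_bijective (wordToCyc_bijective (F := F) (n := n)), Fintype.card_fun,
      Fintype.card_fin]
  have h3 : (Finset.univ.filter fun m : MaximalSpectrum (CycAlg F n) => 1 ∉ m.asIdeal) =
      Finset.univ := Finset.filter_true_of_mem fun m _ hm =>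
        m.isMaximal.ne_top ((Ideal.eq_top_iff_one _).2 hm)
  rw [h2, h3] at h1
  have h4 : Fintype.card F ^ (Finset.univ : Finset (MaximalSpectrum (CycAlg F n))).card ≤
      Fintype.card F ^ n :=
    (Finset.pow_card_le_prod _ _ _ fun m _ => card_le_card_quotient m.isMaximal).trans h1
  exact (Finset.card_le_card (Finset.subset_univ P)).trans
    ((Nat.pow_le_pow_iff_right Fintype.one_lt_card).1 h4)

open scoped Classical in
set_option maxHeartbeats 400000 in
theorem exists_normFiber_forall_lt_hammingNorm (p h : ℕ) [Fact p.Prime] [CharP F p]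
    (hF : Fintype.card F = p ^ h * p ^ h) (hn : n.Prime) (hnF : (n : F) ≠ 0) {δ : ℝ}
    (hδ0 : 0 < δ) (hδ1 : δ < 1 - (Fintype.card F : ℝ)⁻¹)
    (hent : qEntropy (Fintype.card F) δ < 1 / 4) {B : ℕ}
    (hB : B = Fintype.card F ^ orderOf (Fintype.card F : ZMod n)) (hBn : 4 * n ≤ B)
    (hy : 8 * (n : ℝ) ^ 2 * (B : ℝ) ^ (-(1 / 2 - 2 * qEntropy (Fintype.card F) δ)) < 1) :
    ∃ g : CycAlg F n, g * cycStar p h n g = -1 ∧ ∀ u v : Fin n → F, u ≠ 0 →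
      wordToCyc F n v = wordToCyc F n u * g → δ * (2 * n) < (hammingNorm u + hammingNorm v : ℕ) := by
  let : Fintype (CycAlg F n) := Fintype.ofBijective _ (wordToCyc_bijective (F := F) (n := n))
  let : ∀ m : Ideal (CycAlg F n), Fintype (CycAlg F n ⧸ m) := fun m => Fintype.ofFinite _
  let : Fintype (MaximalSpectrum (CycAlg F n)) := Fintype.ofFinite _
  have hred : IsReduced (CycAlg F n) := cycAlg_isReduced hnF
  set q := Fintype.card F with hq
  set σ := cycStar (F := F) p h n with hσdef
  have hσ : ∀ r, σ (σ r) = r := cycStar_cycStar p h hF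
  have hQ : 1 < p ^ h := by
    by_contra! hle
    have : p ^ h * p ^ h ≤ 1 * 1 := Nat.mul_le_mul hle hle
    have h1 : 1 < q := Fintype.one_lt_card
    omega
  have hq4 : 4 ≤ q := by rw [hF]; exact Nat.mul_le_mul hQ hQ
  have hnpos : (0 : ℝ) < n := by exact_mod_cast hn.pos
  have hBpos : (0 : ℝ) < B := by exact_mod_cast (show 0 < B by have := hn.pos; omega)
  set P := Finset.univ.filter fun m : MaximalSpectrum (CycAlg F n) => CycAlg.x F n - 1 ∉ m.asIdeal
    with hP
  have hPc : Pᶜ.card ≤ 1 := by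
    refine Finset.card_le_one.2 fun m hm m' hm' => ?_
    simp only [hP, Finset.compl_filter, Finset.mem_filter, Finset.mem_univ, true_and, not_not]
      at hm hm'
    exact MaximalSpectrum.ext (eq_of_x_sub_one_mem m.isMaximal m'.isMaximal hm hm')
  have hBm : ∀ m ∈ P, B ≤ Fintype.card (CycAlg F n ⧸ m.asIdeal) := by
    intro m hm
    rw [hB]
    exact pow_orderOf_le_card_quotient hn m.isMaximal (Finset.mem_filter.1 hm).2
  have hPcard : P.card ≤ n := card_finset_maximal_le P
  -- The ideal containing x - 1, if any, contributes at most 1/q ≤ 1/4, since q is the square of p^h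
  -- > 1. The others number at most n and contribute at most 1/B ≤ 1/(4n) each.
  have hsum : ∑ m : MaximalSpectrum (CycAlg F n),
      (Fintype.card (CycAlg F n ⧸ m.asIdeal) : ℝ)⁻¹ ≤ 1 / 2 := by
    rw [← Finset.sum_compl_add_sum P]
    have h1 : ∑ m ∈ Pᶜ, (Fintype.card (CycAlg F n ⧸ m.asIdeal) : ℝ)⁻¹ ≤ Pᶜ.card • (1 / 4 : ℝ) := by
      refine Finset.sum_le_card_nsmul _ _ _ fun m _ => ?_
      have := hq4.trans (card_le_card_quotient m.isMaximal)
      rw [one_div]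
      exact inv_anti₀ (by norm_num) (by exact_mod_cast this)
    have h2 : ∑ m ∈ P, (Fintype.card (CycAlg F n ⧸ m.asIdeal) : ℝ)⁻¹ ≤ P.card • (B : ℝ)⁻¹ := by
      refine Finset.sum_le_card_nsmul _ _ _ fun m hm => ?_
      exact inv_anti₀ hBpos (by exact_mod_cast hBm m hm)
    rw [nsmul_eq_mul] at h1 h2
    have h3 : (Pᶜ.card : ℝ) ≤ 1 := by exact_mod_cast hPc
    have h4 : (P.card : ℝ) * (B : ℝ)⁻¹ ≤ 1 / 4 := by
      rw [← div_eq_mul_inv, div_le_iff₀ hBpos]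
      have h5 : (P.card : ℝ) ≤ n := by exact_mod_cast hPcard
      have h6 : (4 * n : ℝ) ≤ B := by exact_mod_cast hBn
      linarith
    linarith
  obtain ⟨θ₀, hθ₀⟩ := exists_pow_ne_self hQ (show p ^ h < q by rw [hF]; nlinarith)
  have hθ : IsUnit (σ (AdjoinRoot.of _ θ₀) - AdjoinRoot.of _ θ₀) := by
    rw [hσdef, cycStar_of, ← map_sub]
    exact (IsUnit.mk0 _ (sub_ne_zero.2 hθ₀)).map _
  obtain ⟨c₀, hc₀⟩ := exists_pow_add_one_eq_neg_one hF
  have hg₀ : AdjoinRoot.of _ c₀ ∈ normFiber σ (-1) := by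
    rw [mem_normFiber, hσdef, cycStar_of, ← map_mul, ← pow_succ', hc₀, map_neg, map_one]
  set D := normFiber σ (-1) with hD
  have hDpos : (0 : ℝ) < D.card := by exact_mod_cast Finset.card_pos.2 ⟨_, hg₀⟩
  set η := qEntropy q δ with hη
  set y : ℝ := (B : ℝ) ^ (-(1 / 2 - 2 * η)) with hydef
  have hy0 : 0 < y := by positivity
  by_contra! hcon
  set 𝓔 := Finset.univ.filter fun e : CycAlg F n => e * e = e ∧ σ e = e ∧ ∃ m ∈ P, e ∉ m.asIdeal
  set L : CycAlg F n → Finset ((Fin n → F) × (Fin n → F)) := fun e =>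
    Finset.univ.filter fun x => (∃ c, e = wordToCyc F n x.1 * c + σ (wordToCyc F n x.1 * c) -
      wordToCyc F n x.1 * c * σ (wordToCyc F n x.1 * c)) ∧ x.1 ∈ cornerCode e ∧
      x.2 ∈ cornerCode e ∧ ((hammingNorm x.1 + hammingNorm x.2 : ℕ) : ℝ) ≤ δ * (2 * n)
  have hcover : D ⊆ 𝓔.biUnion fun e => (L e).biUnion fun x =>
      D.filter fun g => wordToCyc F n x.1 * g = wordToCyc F n x.2 := by
    intro g hg
    have hgσ : g * σ g = -1 := mem_normFiber.1 hg
    obtain ⟨u, v, hu, huv, hw⟩ := hcon g hgσ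
    obtain ⟨e, c, he, hσe, hea, hec⟩ := exists_invariant_idempotent hσ (wordToCyc F n u)
    -- Otherwise u and v are killed by x - 1. Both are then nonzero constant words, of total weight
    -- 2n > 2nδ, and the pair is not light.
    have hem : ∃ m ∈ P, e ∉ m.asIdeal := by
      by_contra! hall
      have h1 : (CycAlg.x F n - 1) * wordToCyc F n u = 0 := by
        refine eq_zero_of_forall_mem_maximal fun m => ?_
        by_cases hm : m ∈ P
        · rw [← hea]
          exact m.asIdeal.mul_mem_left _ (m.asIdeal.mul_mem_right _ (hall m hm))
        · have : CycAlg.x F n - 1 ∈ m.asIdeal := by simpa [hP] using hm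
          exact m.asIdeal.mul_mem_right _ this
      have h2 : (CycAlg.x F n - 1) * wordToCyc F n v = 0 := by
        rw [huv, ← mul_assoc, h1, zero_mul]
      have hv : v ≠ 0 := by
        rintro rfl
        rw [map_zero] at huv
        have h3 : wordToCyc F n u = 0 := by
          linear_combination wordToCyc F n u * hgσ + σ g * huv
        exact hu (wordToCyc_bijective.1 (by rw [h3, map_zero]))
      rw [hammingNorm_of_x_sub_one_mul hu h1, hammingNorm_of_x_sub_one_mul hv h2] at hw
      have hqi : (0 : ℝ) < (q : ℝ)⁻¹ := by
        have : (0 : ℝ) < q := by exact_mod_cast (show 0 < q by omega)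
        positivity
      push_cast at hw
      nlinarith
    refine Finset.mem_biUnion.2 ⟨e, Finset.mem_filter.2 ⟨Finset.mem_univ _, he, hσe, hem⟩,
      Finset.mem_biUnion.2 ⟨(u, v), Finset.mem_filter.2 ⟨Finset.mem_univ _, ⟨c, hec⟩, hea, ?_, hw⟩,
      Finset.mem_filter.2 ⟨hg, huv.symm⟩⟩⟩
    rw [mem_cornerCode, huv, ← mul_assoc, hea]
  have hterm : ∀ e ∈ 𝓔, ∑ x ∈ L e,
      ((D.filter fun g => wordToCyc F n x.1 * g = wordToCyc F n x.2).card : ℝ) ≤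
        2 * n * D.card * y ^ (P.filter fun m => e ∉ m.asIdeal).card := by
    intro e he
    obtain ⟨-, he, hσe, -⟩ := Finset.mem_filter.1 he
    have hE : q ^ Module.finrank F (cornerCode e) = (corner e).card := pow_finrank_cornerCode e
    set E := (corner e).card
    have hEpos : (0 : ℝ) < E := by
      rw [← hE]; exact_mod_cast pow_pos (show 0 < q by omega) _
    have hstab := card_stab_sq_mul_le hσ hθ hsum he hσe
    have hND := card_normFiber_one_le hg₀
    have hpair : ∀ x ∈ L e,
        ((D.filter fun g => wordToCyc F n x.1 * g = wordToCyc F n x.2).card : ℝ) ≤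
          2 * D.card * (E : ℝ) ^ (-(1 / 2) : ℝ) := by
      intro x hx
      obtain ⟨-, ⟨c, hec⟩, -⟩ := Finset.mem_filter.1 hx
      have h1 := card_filter_mul_eq_le hec (wordToCyc F n x.2)
      set A := (D.filter fun g => wordToCyc F n x.1 * g = wordToCyc F n x.2).card
      have h2 : A ^ 2 * E ≤ (2 * D.card) ^ 2 := by
        calc A ^ 2 * E ≤ _ := Nat.mul_le_mul_right _ (Nat.pow_le_pow_left h1 2)
          _ ≤ _ := hstab
          _ ≤ 4 * D.card ^ 2 := Nat.mul_le_mul_left _ (Nat.pow_le_pow_left hND 2)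
          _ = _ := by ring
      have h3 : ((A : ℝ) * √E) ^ 2 ≤ (2 * D.card) ^ 2 := by
        rw [mul_pow, Real.sq_sqrt hEpos.le]
        exact_mod_cast h2
      have h4 := abs_le_of_sq_le_sq' h3 (by positivity)
      rw [Real.rpow_neg hEpos.le, ← Real.sqrt_eq_rpow, ← div_eq_mul_inv,
        le_div_iff₀ (Real.sqrt_pos.2 hEpos)]
      exact h4.2
    have hLcard : ((L e).card : ℝ) ≤ n * (E : ℝ) ^ (2 * η) := by
      have h1 := card_light_pairs_le (cornerCode e) (fun v hv j => translate_mem_cornerCode hv j)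
        hδ0 hδ1
      rw [Fintype.card_fin, ← Nat.cast_pow, ← hq, hE] at h1
      refine le_trans ?_ h1
      refine Nat.cast_le.2 (Finset.card_le_card fun x hx => ?_)
      obtain ⟨-, -, h2⟩ := Finset.mem_filter.1 hx
      exact Finset.mem_filter.2 ⟨Finset.mem_univ _, h2⟩
    have hBE : (B : ℝ) ^ (P.filter fun m => e ∉ m.asIdeal).card ≤ E := by
      have h1 : B ^ (P.filter fun m => e ∉ m.asIdeal).card ≤ ∏ m ∈ P.filter fun m => e ∉ m.asIdeal, Fintype.card (CycAlg F n ⧸ m.asIdeal) :=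
        Finset.pow_card_le_prod _ _ _ fun m hm => hBm m (Finset.mem_filter.1 hm).1
      have h2 : ∏ m ∈ P.filter fun m => e ∉ m.asIdeal, Fintype.card (CycAlg F n ⧸ m.asIdeal) ≤
          ∏ m ∈ Finset.univ.filter (fun m : MaximalSpectrum (CycAlg F n) => e ∉ m.asIdeal),
            Fintype.card (CycAlg F n ⧸ m.asIdeal) :=
        Finset.prod_le_prod_of_subset_of_one_le' (Finset.filter_subset_filter _ (Finset.subset_univ _))
          fun _ _ _ => Fintype.card_pos
      exact_mod_cast h1.trans (h2.trans (prod_card_quotient_le he))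
    calc ∑ x ∈ L e, ((D.filter fun g => wordToCyc F n x.1 * g = wordToCyc F n x.2).card : ℝ)
        ≤ (L e).card • (2 * D.card * (E : ℝ) ^ (-(1 / 2) : ℝ)) :=
          Finset.sum_le_card_nsmul _ _ _ hpair
      _ ≤ (n * (E : ℝ) ^ (2 * η)) * (2 * D.card * (E : ℝ) ^ (-(1 / 2) : ℝ)) := by
          rw [nsmul_eq_mul]; gcongr
      _ = 2 * n * D.card * (E : ℝ) ^ (-(1 / 2 - 2 * η)) := by
          rw [show -(1 / 2 - 2 * η) = 2 * η + -(1 / 2) by ring, Real.rpow_add hEpos]; ring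
      -- The exponent is negative because the entropy is below 1/4, so the lower bound on E gives an
      -- upper bound here.
      _ ≤ 2 * n * D.card * ((B : ℝ) ^ (P.filter fun m => e ∉ m.asIdeal).card) ^ (-(1 / 2 - 2 * η)) := by
          refine mul_le_mul_of_nonneg_left ?_ (by positivity)
          exact Real.rpow_le_rpow_of_nonpos (by positivity) hBE (by linarith)
      _ = 2 * n * D.card * y ^ (P.filter fun m => e ∉ m.asIdeal).card := by
          rw [hydef, ← Real.rpow_natCast, ← Real.rpow_natCast, ← Real.rpow_mul hBpos.le,
            ← Real.rpow_mul hBpos.le, mul_comm (((P.filter fun m => e ∉ m.asIdeal).card : ℝ))]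
  have hsumE : ∑ e ∈ 𝓔, y ^ (P.filter fun m => e ∉ m.asIdeal).card ≤ 2 * ((1 + y) ^ n - 1) := by
    refine (sum_pow_card_le 𝓔 (fun e he => (Finset.mem_filter.1 he).2.1) P
      (fun e he => (Finset.mem_filter.1 he).2.2.2) hPc hy0.le).trans ?_
    have : (1 + y) ^ P.card ≤ (1 + y) ^ n := pow_le_pow_right₀ (by linarith) hPcard
    linarith
  have hny : n * y ≤ 1 := by
    have : (1 : ℝ) ≤ n := by exact_mod_cast hn.one_le
    have h1 : n * y ≤ 8 * (n : ℝ) ^ 2 * y := by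
      refine mul_le_mul_of_nonneg_right ?_ hy0.le
      nlinarith
    linarith
  have hfinal : (D.card : ℝ) ≤ D.card * (8 * (n : ℝ) ^ 2 * y) := by
    calc (D.card : ℝ) ≤ ∑ e ∈ 𝓔, ∑ x ∈ L e,
        ((D.filter fun g => wordToCyc F n x.1 * g = wordToCyc F n x.2).card : ℝ) := by
          exact_mod_cast (Finset.card_le_card hcover).trans (Finset.card_biUnion_le.trans
            (Finset.sum_le_sum fun e _ => Finset.card_biUnion_le))
      _ ≤ ∑ e ∈ 𝓔, 2 * n * D.card * y ^ (P.filter fun m => e ∉ m.asIdeal).card := Finset.sum_le_sum hterm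
      _ = 2 * n * D.card * ∑ e ∈ 𝓔, y ^ (P.filter fun m => e ∉ m.asIdeal).card := by rw [Finset.mul_sum]
      _ ≤ 2 * n * D.card * (2 * (2 * (n * y))) := by
          refine mul_le_mul_of_nonneg_left (hsumE.trans ?_) (by positivity)
          linarith [one_add_pow_sub_one_le hy0.le hny]
      _ = _ := by ring
  have := mul_lt_mul_of_pos_left hy hDpos
  linarith

end Existence

/-! ### Choice of the lengths and conclusion. -/

theorem mainTheorem3 (p ℓ : ℕ) [Fact p.Prime] (hℓ : Even ℓ)
    (F : Type*) [Field F] [Fintype F] [DecidableEq F] [CharP F p]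
    (hF : Fintype.card F = p ^ ℓ)
    (δ : ℝ) (hδ_pos : 0 < δ) (hδ_lt : δ < 1 - ((p ^ ℓ : ℕ) : ℝ)⁻¹)
    (hδ_entropy : qEntropy (p ^ ℓ) δ < 1 / 4) :
    ∃ (n : ℕ → ℕ) (g : ∀ i, CycAlg F (n i))
      (C : ∀ i, Submodule F (Fin (n i) ⊕ Fin (n i) → F)),
      Filter.Tendsto (fun i => 2 * n i) Filter.atTop Filter.atTop ∧
      ∀ i, 1 < n i ∧ (n i).Coprime (p ^ ℓ) ∧
        g i * cycStar p (ℓ / 2) (n i) (g i) = -1 ∧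
        C i = pairCode 1 (g i) ∧
        IsTwoQuasiCyclic (C i) ∧
        IsHermitianSelfDual p ℓ (C i) ∧
        codeRate (C i) = 1 / 2 ∧
        δ < relMinDistance (C i) := by
  have hsq : Fintype.card F = p ^ (ℓ / 2) * p ^ (ℓ / 2) := by
    rw [hF, ← pow_add, ← two_mul, Nat.two_mul_div_two_of_even hℓ]
  have hq2 : 2 ≤ Fintype.card F := Fintype.one_lt_card
  rw [← hF] at hδ_lt hδ_entropy
  set κ : ℝ := 1 / 2 - 2 * qEntropy (Fintype.card F) δ with hκ
  have hκ0 : 0 < κ := by linarith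
  -- The ceiling gives Aκ ≥ 3, hence B^(-κ) ≤ n^(-3) and 8n²B^(-κ) ≤ 8/n. The summand 2 gives n² ≤
  -- n^A ≤ B, hence 4n ≤ B.
  set A : ℕ := ⌈3 / κ⌉₊ + 2 with hA
  have hAκ : 3 ≤ A * κ := by
    rw [← div_le_iff₀ hκ0]
    refine (Nat.le_ceil _).trans ?_
    exact_mod_cast Nat.le_add_right _ _
  -- In the lower bound for n, the term i forces divergence, the term q makes n coprime to q and
  -- different from p, and the term 8 makes 8/n < 1.
  choose n hn using fun i : ℕ =>
    exists_prime_pow_le_pow_orderOf hq2 A (i + Fintype.card F + 8)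
  have hpos : ∀ i, NeZero (n i) := fun i => ⟨(hn i).1.ne_zero⟩
  have hcop : ∀ i, (n i).Coprime (p ^ ℓ) := by
    intro i
    rw [← hF]
    exact Nat.coprime_of_lt_prime Fintype.card_ne_zero (by have := (hn i).2.1; omega) (hn i).1
  have hnF : ∀ i, (n i : F) ≠ 0 := by
    intro i h0
    have h1 : p ∣ n i := (CharP.cast_eq_zero_iff F p _).1 h0
    have h2 : p = n i := (Nat.prime_dvd_prime_iff_eq Fact.out (hn i).1).1 h1
    have h3 : p ∣ Fintype.card F := by
      rw [hF]
      refine dvd_pow_self p ?_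
      rintro rfl
      rw [hF, pow_zero] at hq2
      omega
    have := Nat.le_of_dvd (by omega) h3
    have := (hn i).2.1
    omega
  have hex := fun i => exists_normFiber_forall_lt_hammingNorm (F := F) (n := n i) p (ℓ / 2) hsq
    (hn i).1 (hnF i) hδ_pos hδ_lt hδ_entropy rfl (by
      refine le_trans ?_ (hn i).2.2
      calc 4 * n i ≤ n i * n i := Nat.mul_le_mul_right _ (by have := (hn i).2.1; omega)
        _ = n i ^ 2 := (sq _).symm
        _ ≤ n i ^ A := Nat.pow_le_pow_right (hn i).1.pos (Nat.le_add_left 2 _)) (by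
      have h9 : (8 : ℝ) < n i := by exact_mod_cast (show 8 < n i by have := (hn i).2.1; omega)
      have hn0 : (0 : ℝ) < n i := by linarith
      have h1 : ((Fintype.card F ^ orderOf (Fintype.card F : ZMod (n i)) : ℕ) : ℝ) ^ (-κ) ≤
          (n i : ℝ) ^ (-3 : ℝ) := by
        calc _ ≤ ((n i : ℝ) ^ A) ^ (-κ) := by
              refine Real.rpow_le_rpow_of_nonpos (by positivity) ?_ (by linarith)
              exact_mod_cast (hn i).2.2
          _ = (n i : ℝ) ^ (-(A * κ)) := by
              rw [← Real.rpow_natCast, ← Real.rpow_mul hn0.le]; ring_nf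
          _ ≤ _ := Real.rpow_le_rpow_of_exponent_le (by linarith) (by linarith)
      calc _ ≤ 8 * (n i : ℝ) ^ 2 * (n i : ℝ) ^ (-3 : ℝ) :=
            mul_le_mul_of_nonneg_left h1 (by positivity)
        _ = 8 / n i := by
            rw [Real.rpow_neg hn0.le, show (3 : ℝ) = ((3 : ℕ) : ℝ) by norm_num, Real.rpow_natCast]
            field_simp
        _ < 1 := by rwa [div_lt_one hn0])
  choose g hg hw using hex
  refine ⟨n, g, fun i => pairCode 1 (g i), ?_, fun i => ⟨(hn i).1.one_lt, hcop i, hg i, rfl,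
    isTwoQuasiCyclic_pairCode _, isGaloisSelfDual_pairCode p (ℓ / 2) hsq (hg i),
    codeRate_pairCode _, ?_⟩⟩
  · refine Filter.tendsto_atTop_mono (fun i => ?_) Filter.tendsto_id
    have := (hn i).2.1
    simp only [id]
    omega
  · refine lt_relMinDistance_pairCode fun u v hu huv => ?_
    convert hw i u v hu huv
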